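/- Let $p,q,\beta,\overline c$ be real numbers with $q,\beta,\overline c>0$. On a probability space $(\Omega,\mathcal F,\mathbb P)$ let $N=(N_t)_{t\ge0}$ be a Poisson process with intensity $\beta$ and let $U_1,U_2,\dots$ be i.i.d. nonnegative integrable claim sizes, independent of $N$, whose common distribution function is globally Lipschitz, and assume the safety loading condition $p>\beta\,\mathbb E[U_1]$. For $x\ge 0$ let $X_t=x+pt-\sum_{i=1}^{N_t}U_i$ be the surplus with initial value $x$, and let $(\mathcal F_t)_{t\ge0}$ be the filtration generated by $X$ and the null events. For $c\in[0,\overline c]$ let $\Pi_{x,c,\overline c}$ be the set of càdlàg, $(\mathcal F_t)$-adapted, non-decreasing processes $C=(C_t)_{t\ge0}$ with $c\le C_t\le\overline c$ for all $t$. For such $C$ put $X^C_t=X_t-\int_0^tC_s\,ds$, $\tau=\inf\{t\ge0:X^C_t<0\}$ (with $\inf\emptyset=\infty$) and $$J(x;C)=\mathbb E\Big[\int_0^\tau e^{-qs}C_s\,ds\Big].$$ For $n\ge 0$ let $\mathcal G^n=\{k\overline c/2^n:\ k=0,\dots,2^n\}$, with the point $p$ added if $\overline c>p$, and let $$V^n(x,c)=\sup\{J(x;C):\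 C\in\Pi_{x,c,\overline c},\ C_t\in\mathcal G^n\text{ for all }t\ge 0\},\qquad x\ge0,\ c\in[0,\overline c].$$ Then the limit $\overline V(x,c)=\lim_{n\to\infty}V^n(x,c)$ exists for all $x\ge0$ and $c\in[0,\overline c]$, and: 1. if $\overline c\le p$, then $V^n\to\overline V$ uniformly on $[0,\infty)\times[0,\overline c]$; 2. if $\overline c>p$, then for every $c_1>p$, $V^n\to\overline V$ uniformly on $[0,\infty)\times[c_1,\overline c]$. -/

import Mathlib

open MeasureTheory ProbabilityTheory Filter Topology

namespace Ratcheting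

noncomputable section

/-- Arrival time of the claim with index `i` (claims are indexed from `0`); `W j` is the waiting
time between the claims with indices `j - 1` and `j`. -/
def arrivalTime {Ω : Type*} (W : ℕ → Ω → ℝ) (i : ℕ) (ω : Ω) : ℝ :=
  ∑ j ∈ Finset.range (i + 1), W j ω

/-- The number `N_t` of claims up to time `t`. For independent exponential waiting times of rate `β`
this is a Poisson process of intensity `β` (almost surely finite for all `t`). -/
def claimCount {Ω : Type*} (W : ℕ → Ω → ℝ) (t : ℝ) (ω : Ω) : ℕ :=
  Set.ncard {i : ℕ | arrivalTime W i ω ≤ t}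

/-- The free surplus `X_t = x + p t - ∑_{i ≤ N_t} U_i`. -/
def surplus {Ω : Type*} (W U : ℕ → Ω → ℝ) (p x t : ℝ) (ω : Ω) : ℝ :=
  x + p * t - ∑ i ∈ Finset.range (claimCount W t ω), U i ω

/-- The σ-algebra `𝓕_t` generated by the free surplus up to time `t` and by the null events.
(The initial surplus is irrelevant here, so it is taken to be `0`.) -/
@[reducible] def surplusFiltration {Ω : Type*} [MeasurableSpace Ω] (μ : Measure Ω) (W U : ℕ → Ω → ℝ) (p : ℝ)
    (t : ℝ) : MeasurableSpace Ω :=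
  (⨆ s ∈ Set.Icc (0 : ℝ) t, MeasurableSpace.comap (surplus W U p 0 s) inferInstance) ⊔
    MeasurableSpace.generateFrom {A : Set Ω | MeasurableSet A ∧ μ A = 0}

/-- Admissible dividend ratcheting strategies (only times `t ≥ 0` matter): adapted,
non-decreasing, càdlàg, with values in `[c, cbar]`. The existence of left limits follows from
monotonicity. -/
structure IsAdmissible {Ω : Type*} [MeasurableSpace Ω] (μ : Measure Ω) (W U : ℕ → Ω → ℝ)
    (p cbar c : ℝ) (C : ℝ → Ω → ℝ) : Prop where
  adapted : ∀ t : ℝ, 0 ≤ t → Measurable[surplusFiltration μ W U p t] (C t)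
  monotone : ∀ ω : Ω, MonotoneOn (fun t => C t ω) (Set.Ici 0)
  rightContinuous : ∀ ω : Ω, ∀ t : ℝ, 0 ≤ t → ContinuousWithinAt (fun s => C s ω) (Set.Ici t) t
  bounds : ∀ ω : Ω, ∀ t : ℝ, 0 ≤ t → c ≤ C t ω ∧ C t ω ≤ cbar

/-- The controlled surplus `X_t^C = X_t - ∫_0^t C_s ds`. -/
def controlledSurplus {Ω : Type*} (W U : ℕ → Ω → ℝ) (p x : ℝ) (C : ℝ → Ω → ℝ) (t : ℝ) (ω : Ω) : ℝ :=
  surplus W U p x t ω - ∫ s in (0 : ℝ)..t, C s ω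

/-- The ruin time `τ = inf {t ≥ 0 : X_t^C < 0}`, equal to `⊤` if ruin never occurs. -/
def ruinTime {Ω : Type*} (W U : ℕ → Ω → ℝ) (p x : ℝ) (C : ℝ → Ω → ℝ) (ω : Ω) : EReal :=
  sInf ((fun t : ℝ => (t : EReal)) '' {t : ℝ | 0 ≤ t ∧ controlledSurplus W U p x C t ω < 0})

/-- The expected discounted dividends until ruin, `J(x; C) = E[∫_0^τ e^{-qs} C_s ds]`. -/
def payoff {Ω : Type*} [MeasurableSpace Ω] (μ : Measure Ω) (W U : ℕ → Ω → ℝ) (p q x : ℝ)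
    (C : ℝ → Ω → ℝ) : ℝ :=
  ∫ ω, (∫ s in {s : ℝ | 0 ≤ s ∧ (s : EReal) < ruinTime W U p x C ω},
    Real.exp (-q * s) * C s ω) ∂μ

/-- The optimal value `V^G(x, c)` among the admissible strategies with dividend rates in `G`. -/
def gridValue {Ω : Type*} [MeasurableSpace Ω] (μ : Measure Ω) (W U : ℕ → Ω → ℝ) (p q cbar : ℝ)
    (G : Set ℝ) (x c : ℝ) : ℝ :=
  sSup (payoff μ W U p q x ''
    {C | IsAdmissible μ W U p cbar c C ∧ ∀ ω : Ω, ∀ t : ℝ, 0 ≤ t → C t ω ∈ G})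

/-- The dyadic grid `G^n = {k cbar / 2^n : 0 ≤ k ≤ 2^n}`, with `p` added when `cbar > p`. -/
def dyadicGrid (p cbar : ℝ) (n : ℕ) : Set ℝ :=
  {g | (∃ k : ℕ, k ≤ 2 ^ n ∧ g = (k : ℝ) / 2 ^ n * cbar) ∨ (p < cbar ∧ g = p)}

/-- `V^n = V^{G^n}`. -/
def Vn {Ω : Type*} [MeasurableSpace Ω] (μ : Measure Ω) (W U : ℕ → Ω → ℝ) (p q cbar : ℝ)
    (n : ℕ) (x c : ℝ) : ℝ :=
  gridValue μ W U p q cbar (dyadicGrid p cbar n) x c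

/-- The pointwise limit of the functions `V^n`. -/
def Vbar {Ω : Type*} [MeasurableSpace Ω] (μ : Measure Ω) (W U : ℕ → Ω → ℝ) (p q cbar : ℝ)
    (x c : ℝ) : ℝ :=
  limUnder atTop (fun n : ℕ => Vn μ W U p q cbar n x c)

end

end Ratcheting

namespace Ratcheting

/-! The dyadic grids are nested and every payoff is at most `cbar / q`, so `Vn` increases in `n` and
converges pointwise (`tendsto_Vn`). For uniformity, take a strategy `C` on any grid `m` and round it
up to the grid `n`. The result `D` satisfies `C ≤ D ≤ C + δ` with `δ = cbar / 2 ^ n`; it pays more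
while it survives and loses only through earlier ruin. If this loss is small uniformly in `m`, `x`,
`c` and `C`, convergence is uniform (`tendstoUniformlyOn_Vn`). Discounting makes times after a large
`T` negligible, and up to time `T` the two surpluses differ by at most `δ T`.

When all rates are at least `c₁ > p`, the surplus falls at rate at least `c₁ - p`, so the gap `δ T`
is used up within time `δ T / (c₁ - p)`: `C` barely outlives `D` (`survival_subset_of_drift_neg`).

When all rates are at most `p`, ruin happens only at claims, so `D` is ruined before `C` only if
some claim leaves `C` with a surplus in `[0, δ T)` (`exists_small_surplus_of_drift_nonneg`). The
claim size is independent of the surplus just before the claim, and its distribution function is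
`K`-Lipschitz, so each claim does this with probability at most `K δ T`
(`IsAdmissible.measure_small_surplus_le`). With high probability fewer than some `N` claims matter
before `T`, and a union bound concludes. -/

/-- The paths outside a null event: nonnegative waiting times and claims, no explosion. -/
structure IsRegularPath {Ω : Type*} (W U : ℕ → Ω → ℝ) (ω : Ω) : Prop where
  waiting_nonneg : ∀ i, 0 ≤ W i ω
  claim_nonneg : ∀ i, 0 ≤ U i ω
  tendsto_arrivalTime : Tendsto (fun i => arrivalTime W i ω) atTop atTop

/-! ### Path properties of claim counts, surplus and ruin. -/

section Paths

variable {Ω : Type*} {W U : ℕ → Ω → ℝ} {p x : ℝ} {ω : Ω}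

theorem IsRegularPath.arrivalTime_mono (h : IsRegularPath W U ω) :
    Monotone fun i => arrivalTime W i ω := by
  refine monotone_nat_of_le_succ fun i => ?_
  simp only [arrivalTime]
  rw [Finset.sum_range_succ _ (i + 1)]
  linarith [h.waiting_nonneg (i + 1)]

theorem IsRegularPath.arrivalTime_nonneg (h : IsRegularPath W U ω) (i : ℕ) :
    0 ≤ arrivalTime W i ω :=
  Finset.sum_nonneg fun j _ => h.waiting_nonneg j

/-- Without explosion the indices of the arrived claims form a finite initial segment of `ℕ`, so
`Set.ncard` is the true count and not its default value `0` on infinite sets. -/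
theorem IsRegularPath.lt_claimCount_iff (h : IsRegularPath W U ω) (t : ℝ) (j : ℕ) :
    j < claimCount W t ω ↔ arrivalTime W j ω ≤ t := by
  classical
  have hex : ∃ n, t < arrivalTime W n ω := (h.tendsto_arrivalTime.eventually_gt_atTop t).exists
  have hset : {i : ℕ | arrivalTime W i ω ≤ t} = Set.Iio (Nat.find hex) := by
    ext i
    simp only [Set.mem_ofPred_eq, Set.mem_Iio]
    refine ⟨fun hi => ?_, fun hi => not_lt.1 (Nat.find_min hex hi)⟩
    by_contra hc
    exact absurd (h.arrivalTime_mono (not_lt.1 hc)) (not_le.2 (hi.trans_lt (Nat.find_spec hex)))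
  have hc : claimCount W t ω = Nat.find hex := by
    rw [claimCount, hset, ← Finset.coe_Iio, Set.ncard_coe_finset, Nat.card_Iio]
  rw [hc, ← Set.mem_Iio, ← hset, Set.mem_ofPred_eq]

theorem IsRegularPath.claimCount_le_iff (h : IsRegularPath W U ω) (t : ℝ) (j : ℕ) :
    claimCount W t ω ≤ j ↔ t < arrivalTime W j ω := by
  rw [← not_lt, h.lt_claimCount_iff, not_le]

theorem IsRegularPath.claimCount_mono (h : IsRegularPath W U ω) :
    Monotone fun t => claimCount W t ω := by
  intro s t hst
  refine le_of_forall_lt fun j hj => ?_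
  rw [h.lt_claimCount_iff] at hj ⊢
  exact hj.trans hst

theorem IsRegularPath.claimCount_eventually_eq (h : IsRegularPath W U ω) (t : ℝ) :
    ∀ᶠ s in 𝓝[≥] t, claimCount W s ω = claimCount W t ω := by
  have h1 : t < arrivalTime W (claimCount W t ω) ω := (h.claimCount_le_iff _ _).1 le_rfl
  filter_upwards [self_mem_nhdsWithin, mem_nhdsWithin_of_mem_nhds (Iio_mem_nhds h1)] with s hs hs'
  exact le_antisymm ((h.claimCount_le_iff _ _).2 hs') (h.claimCount_mono hs)

theorem IsRegularPath.surplus_le (h : IsRegularPath W U ω) {s t : ℝ} (hst : s ≤ t) :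
    surplus W U p x t ω ≤ surplus W U p x s ω + p * (t - s) := by
  have := Finset.sum_le_sum_of_subset_of_nonneg
    (Finset.range_mono (h.claimCount_mono hst)) (f := fun i => U i ω)
    fun i _ _ => h.claim_nonneg i
  simp only [surplus]
  linarith

theorem surplus_eq_of_claimCount_eq {s t : ℝ} (hst : claimCount W s ω = claimCount W t ω) :
    surplus W U p x t ω = surplus W U p x s ω + p * (t - s) := by
  simp only [surplus, hst]
  ring

theorem IsRegularPath.surplus_rightContinuous (h : IsRegularPath W U ω) (t : ℝ) :
    ContinuousWithinAt (fun s => surplus W U p x s ω) (Set.Ici t) t := by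
  have h1 : ContinuousWithinAt (fun s => surplus W U p x t ω + p * (s - t)) (Set.Ici t) t := by
    fun_prop
  refine h1.congr_of_eventuallyEq ?_ (by simp)
  filter_upwards [h.claimCount_eventually_eq t] with s hs
  exact surplus_eq_of_claimCount_eq hs.symm

/-- Before the arrival of claim `i`, the aggregate claim only involves the previous claims. -/
theorem IsRegularPath.surplus_eq_of_lt_arrivalTime (h : IsRegularPath W U ω) {s : ℝ} {i : ℕ}
    (hs : s < arrivalTime W i ω) :
    surplus W U p x s ω = x + p * s -
      ∑ j ∈ Finset.range i, if arrivalTime W j ω ≤ s then U j ω else 0 := by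
  have h1 : claimCount W s ω ≤ i := (h.claimCount_le_iff _ _).2 hs
  rw [surplus, ← Finset.sum_filter]
  congr 2
  ext j
  rw [Finset.mem_filter, Finset.mem_range, Finset.mem_range, ← h.lt_claimCount_iff s j]
  exact ⟨fun hj => ⟨hj.trans_le h1, hj⟩, fun hj => hj.2⟩

theorem MonotoneOn.intervalIntegrable_of_nonneg {f : ℝ → ℝ} (hf : MonotoneOn f (Set.Ici 0))
    {a b : ℝ} (ha : 0 ≤ a) (hb : 0 ≤ b) : IntervalIntegrable f volume a b :=
  (hf.mono fun _ hs => le_trans (le_min ha hb) hs.1).intervalIntegrable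

/-- Increment of the accumulated dividends. -/
theorem controlledSurplus_sub {C : ℝ → Ω → ℝ} (hC : MonotoneOn (fun t => C t ω) (Set.Ici 0))
    {s t : ℝ} (hs : 0 ≤ s) (ht : 0 ≤ t) :
    controlledSurplus W U p x C t ω - controlledSurplus W U p x C s ω =
      surplus W U p x t ω - surplus W U p x s ω - ∫ r in s..t, C r ω := by
  have := intervalIntegral.integral_add_adjacent_intervals
    (MonotoneOn.intervalIntegrable_of_nonneg hC le_rfl hs)
    (MonotoneOn.intervalIntegrable_of_nonneg hC hs ht)
  simp only [controlledSurplus]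
  linarith

theorem controlledSurplus_rightContinuous (h : IsRegularPath W U ω) {C : ℝ → Ω → ℝ}
    (hC : MonotoneOn (fun t => C t ω) (Set.Ici 0)) {t : ℝ} (ht : 0 ≤ t) :
    ContinuousWithinAt (fun s => controlledSurplus W U p x C s ω) (Set.Ici t) t := by
  refine (h.surplus_rightContinuous t).sub ?_
  have h1 : ContinuousOn (fun s => ∫ r in (0 : ℝ)..s, C r ω) (Set.Icc 0 (t + 1)) := by
    have := intervalIntegral.continuousOn_primitive_interval
      (f := fun r => C r ω) (a := 0) (b := t + 1) (μ := volume) ?_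
    · rwa [Set.uIcc_of_le (by linarith)] at this
    · rw [Set.uIcc_of_le (by linarith)]
      exact (intervalIntegrable_iff_integrableOn_Icc_of_le (by linarith)).1
        (MonotoneOn.intervalIntegrable_of_nonneg hC le_rfl (by linarith))
  refine (h1 t ⟨ht, by linarith⟩).mono_of_mem_nhdsWithin ?_
  filter_upwards [self_mem_nhdsWithin,
    mem_nhdsWithin_of_mem_nhds (Iio_mem_nhds (show t < t + 1 by linarith))] with s hs hs'
  exact ⟨ht.trans hs, le_of_lt hs'⟩

theorem controlledSurplus_nonneg_of_lt_ruinTime {C : ℝ → Ω → ℝ} {t : ℝ} (ht : 0 ≤ t)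
    (h : (t : EReal) < ruinTime W U p x C ω) : 0 ≤ controlledSurplus W U p x C t ω := by
  by_contra hc
  exact not_le.2 h (sInf_le ⟨t, ⟨ht, not_le.1 hc⟩, rfl⟩)

theorem exists_controlledSurplus_neg {C : ℝ → Ω → ℝ} {a : EReal}
    (h : ruinTime W U p x C ω < a) :
    ∃ t : ℝ, 0 ≤ t ∧ (t : EReal) < a ∧ controlledSurplus W U p x C t ω < 0 := by
  obtain ⟨_, ⟨t, ht, rfl⟩, hta⟩ := sInf_lt_iff.1 h
  exact ⟨t, ht.1, hta, ht.2⟩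

/-- Raising the dividend rate by at most `δ` lowers the surplus at time `t` by at most `δ t`. -/
theorem controlledSurplus_le_add {C D : ℝ → Ω → ℝ} {δ : ℝ}
    (hC : MonotoneOn (fun t => C t ω) (Set.Ici 0)) (hD : MonotoneOn (fun t => D t ω) (Set.Ici 0))
    (hDC : ∀ t, 0 ≤ t → D t ω ≤ C t ω + δ) {t : ℝ} (ht : 0 ≤ t) :
    controlledSurplus W U p x C t ω ≤ controlledSurplus W U p x D t ω + δ * t := by
  have h1 := intervalIntegral.integral_mono_on ht
    (MonotoneOn.intervalIntegrable_of_nonneg hD le_rfl ht)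
    ((MonotoneOn.intervalIntegrable_of_nonneg hC le_rfl ht).add
      (intervalIntegrable_const (c := δ))) fun s hs => hDC s hs.1
  rw [intervalIntegral.integral_add (MonotoneOn.intervalIntegrable_of_nonneg hC le_rfl ht)
    (intervalIntegrable_const (c := δ))] at h1
  simp only [intervalIntegral.integral_const, smul_eq_mul, sub_zero] at h1
  simp only [controlledSurplus]
  linarith

/-- Claims only lower the surplus, so its growth is at most premiums minus dividends; for `p < c₁`
this is a strict downward drift. -/
theorem controlledSurplus_antitone_of_lt {C : ℝ → Ω → ℝ} (h : IsRegularPath W U ω) {c₁ : ℝ}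
    (hC : MonotoneOn (fun t => C t ω) (Set.Ici 0)) (hc : ∀ t, 0 ≤ t → c₁ ≤ C t ω)
    {s t : ℝ} (hs : 0 ≤ s) (hst : s ≤ t) :
    controlledSurplus W U p x C t ω ≤ controlledSurplus W U p x C s ω - (c₁ - p) * (t - s) := by
  have h1 := intervalIntegral.integral_mono_on hst (intervalIntegrable_const (c := c₁))
    (MonotoneOn.intervalIntegrable_of_nonneg hC hs (hs.trans hst)) fun r hr => hc r (hs.trans hr.1)
  simp only [intervalIntegral.integral_const, smul_eq_mul] at h1
  have h2 := controlledSurplus_sub (W := W) (U := U) (p := p) (x := x) hC hs (hs.trans hst)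
  have h3 := h.surplus_le (p := p) (x := x) hst
  linarith

/-- If the dividend rate always exceeds `p` by a margin, a slightly larger rate hastens ruin
only slightly. -/
theorem survival_subset_of_drift_neg {C D : ℝ → Ω → ℝ} {δ c₁ T : ℝ} (h : IsRegularPath W U ω)
    (hC : MonotoneOn (fun t => C t ω) (Set.Ici 0)) (hD : MonotoneOn (fun t => D t ω) (Set.Ici 0))
    (hDC : ∀ t, 0 ≤ t → D t ω ≤ C t ω + δ) (hc : ∀ t, 0 ≤ t → c₁ ≤ C t ω) (hpc : p < c₁)
    (hδ : 0 ≤ δ) {r s : ℝ} (hr0 : 0 ≤ r) (hrT : r < T)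
    (hr : controlledSurplus W U p x D r ω < 0) (hs : (s : EReal) < ruinTime W U p x C ω) :
    s < r + δ * T / (c₁ - p) := by
  -- At time `r` the surplus under `D` is negative, so that under `C` is below `δ r ≤ δ T`. Falling
  -- at rate at least `c₁ - p`, it would be negative at time `s`.
  by_contra hcon
  rw [not_lt] at hcon
  have hp : 0 < c₁ - p := sub_pos.2 hpc
  have hq : 0 ≤ δ * T / (c₁ - p) := by
    have : 0 ≤ T := hr0.trans hrT.le
    positivity
  have h1 := controlledSurplus_nonneg_of_lt_ruinTime ((hr0.trans (by linarith)).trans hcon) hs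
  have h2 := controlledSurplus_antitone_of_lt (p := p) (x := x) h hC hc hr0
    (show r ≤ s by linarith)
  have h3 := controlledSurplus_le_add (W := W) (U := U) (p := p) (x := x) hC hD hDC hr0
  have h4 : δ * r ≤ δ * T := mul_le_mul_of_nonneg_left hrT.le hδ
  have h5 : δ * T ≤ (c₁ - p) * (s - r) := by
    calc δ * T = (c₁ - p) * (δ * T / (c₁ - p)) := by field_simp
      _ ≤ _ := mul_le_mul_of_nonneg_left (by linarith) hp.le
  linarith

/-- If the dividend rate never exceeds `p`, ruin occurs at claim times only; so if a slightly larger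
rate ruins the company earlier, then the surplus was small right after some claim. -/
theorem exists_small_surplus_of_drift_nonneg {C D : ℝ → Ω → ℝ} {δ T : ℝ} (hx : 0 ≤ x)
    (h : IsRegularPath W U ω) (hC : MonotoneOn (fun t => C t ω) (Set.Ici 0))
    (hD : MonotoneOn (fun t => D t ω) (Set.Ici 0))
    (hDC : ∀ t, 0 ≤ t → D t ω ≤ C t ω + δ) (hDp : ∀ t, 0 ≤ t → D t ω ≤ p) (hδ : 0 ≤ δ) {r : ℝ}
    (hr0 : 0 ≤ r) (hrT : r < T)
    (hr : controlledSurplus W U p x D r ω < 0) (hs : (r : EReal) < ruinTime W U p x C ω) :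
    ∃ i, arrivalTime W i ω < T ∧
      claimCount W (arrivalTime W i ω) ω = i + 1 ∧
      0 ≤ controlledSurplus W U p x C (arrivalTime W i ω) ω ∧
      controlledSurplus W U p x C (arrivalTime W i ω) ω < δ * T := by
  have hint : ∀ {s t : ℝ}, 0 ≤ s → s ≤ t → ∫ a in s..t, D a ω ≤ p * (t - s) := by
    intro s t hs hst
    have h1 := intervalIntegral.integral_mono_on hst
      (MonotoneOn.intervalIntegrable_of_nonneg hD hs (hs.trans hst))
      (intervalIntegrable_const (c := p)) fun r hr => hDp r (hs.trans hr.1)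
    simp only [intervalIntegral.integral_const, smul_eq_mul] at h1
    linarith
  -- With no claim up to `r`, the surplus under `D` is at least `x ≥ 0`. Otherwise let `i` be the
  -- last claim up to `r`: the surplus under `D` does not decrease from then until `r`, so it was
  -- already negative at that claim.
  rcases Nat.eq_zero_or_pos (claimCount W r ω) with hk | hk
  · have := hint le_rfl hr0
    simp only [controlledSurplus, surplus, hk, Finset.range_zero, Finset.sum_empty] at hr
    linarith
  · obtain ⟨i, hi⟩ : ∃ i, claimCount W r ω = i + 1 := ⟨_, (Nat.sub_add_cancel hk).symm⟩
    have hir : arrivalTime W i ω ≤ r := (h.lt_claimCount_iff r i).1 (by omega)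
    have hi0 := h.arrivalTime_nonneg i
    -- Should several claims arrive together, `i` is the last of them.
    have hcount : claimCount W (arrivalTime W i ω) ω = i + 1 :=
      le_antisymm (hi ▸ h.claimCount_mono hir) ((h.lt_claimCount_iff _ i).2 le_rfl)
    refine ⟨i, hir.trans_lt hrT, hcount, ?_, ?_⟩
    · exact controlledSurplus_nonneg_of_lt_ruinTime hi0
        ((EReal.coe_le_coe_iff.2 hir).trans_lt hs)
    · have h1 := controlledSurplus_sub (W := W) (U := U) (p := p) (x := x) hD hi0 hr0
      rw [surplus_eq_of_claimCount_eq (hcount.trans hi.symm)] at h1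
      have h2 := hint hi0 hir
      have h3 := controlledSurplus_le_add (W := W) (U := U) (p := p) (x := x) hC hD hDC hi0
      have h4 : δ * arrivalTime W i ω ≤ δ * T := mul_le_mul_of_nonneg_left (hir.trans hrT.le) hδ
      linarith

end Paths

/-! ### Pathwise comparison of discounted dividends. -/

section DiscountedDividends

/-- The discounted dividends paid until ruin along a path. -/
noncomputable def discountedDividends {Ω : Type*} (W U : ℕ → Ω → ℝ) (p q x : ℝ)
    (C : ℝ → Ω → ℝ) (ω : Ω) : ℝ :=
  ∫ s in {s : ℝ | 0 ≤ s ∧ (s : EReal) < ruinTime W U p x C ω}, Real.exp (-q * s) * C s ω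

theorem payoff_eq_integral_discountedDividends {Ω : Type*} [MeasurableSpace Ω] (μ : Measure Ω)
    (W U : ℕ → Ω → ℝ) (p q x : ℝ) (C : ℝ → Ω → ℝ) :
    payoff μ W U p q x C = ∫ ω, discountedDividends W U p q x C ω ∂μ := rfl

theorem measurableSet_survival (τ : EReal) : MeasurableSet {s : ℝ | 0 ≤ s ∧ (s : EReal) < τ} :=
  measurableSet_Ici.inter (measurable_coe_real_ereal measurableSet_Iio)

theorem integrableOn_exp_neg_mul_Ici {q : ℝ} (hq : 0 < q) (T : ℝ) :
    IntegrableOn (fun s => Real.exp (-q * s)) (Set.Ici T) :=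
  (integrableOn_Ici_iff_integrableOn_Ioi (by finiteness)).2 (integrableOn_exp_mul_Ioi (neg_neg_of_pos hq) T)

theorem integral_exp_neg_mul_Ici {q : ℝ} (hq : 0 < q) (T : ℝ) :
    ∫ s in Set.Ici T, Real.exp (-q * s) = Real.exp (-q * T) / q := by
  rw [integral_Ici_eq_integral_Ioi, integral_exp_mul_Ioi (neg_neg_of_pos hq), neg_div_neg_eq]

theorem integrableOn_exp_neg_mul_mul {q cbar : ℝ} (hq : 0 < q) {f : ℝ → ℝ}
    (hf : MonotoneOn f (Set.Ici 0)) (hf0 : ∀ s, 0 ≤ s → 0 ≤ f s)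
    (hf1 : ∀ s, 0 ≤ s → f s ≤ cbar) :
    IntegrableOn (fun s => Real.exp (-q * s) * f s) (Set.Ici 0) := by
  refine Integrable.mono' ((integrableOn_exp_neg_mul_Ici hq 0).const_mul cbar)
    (AEMeasurable.aestronglyMeasurable ?_) ?_
  · exact (by fun_prop : Measurable fun s => Real.exp (-q * s)).aemeasurable.mul
      (aemeasurable_restrict_of_monotoneOn measurableSet_Ici hf)
  · refine (ae_restrict_mem measurableSet_Ici).mono fun s hs => ?_
    rw [Real.norm_of_nonneg (mul_nonneg (Real.exp_pos _).le (hf0 s hs)), mul_comm]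
    exact mul_le_mul_of_nonneg_right (hf1 s hs) (Real.exp_pos _).le

variable {Ω : Type*} {W U : ℕ → Ω → ℝ} {p q x cbar : ℝ} {ω : Ω} {C D : ℝ → Ω → ℝ}

theorem discountedDividends_nonneg (hC0 : ∀ s, 0 ≤ s → 0 ≤ C s ω) :
    0 ≤ discountedDividends W U p q x C ω :=
  setIntegral_nonneg (measurableSet_survival _) fun s hs =>
    mul_nonneg (Real.exp_pos _).le (hC0 s hs.1)

/-- A larger dividend rate loses at most the dividends paid on the times `A` at which only the
smaller rate survives. -/
theorem discountedDividends_le_add (hq : 0 < q)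
    (hC : MonotoneOn (fun t => C t ω) (Set.Ici 0)) (hD : MonotoneOn (fun t => D t ω) (Set.Ici 0))
    (hC0 : ∀ s, 0 ≤ s → 0 ≤ C s ω) (hCD : ∀ s, 0 ≤ s → C s ω ≤ D s ω)
    (hD1 : ∀ s, 0 ≤ s → D s ω ≤ cbar) {A : Set ℝ} (hA : MeasurableSet A) (hA0 : A ⊆ Set.Ici 0)
    (hsub : ∀ s : ℝ, 0 ≤ s → (s : EReal) < ruinTime W U p x C ω →
      (s : EReal) < ruinTime W U p x D ω ∨ s ∈ A) :
    discountedDividends W U p q x C ω ≤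
      discountedDividends W U p q x D ω + cbar * ∫ s in A, Real.exp (-q * s) := by
  have hcbar : 0 ≤ cbar := (hC0 0 le_rfl).trans ((hCD 0 le_rfl).trans (hD1 0 le_rfl))
  have hSC := measurableSet_survival (ruinTime W U p x C ω)
  have hSD := measurableSet_survival (ruinTime W U p x D ω)
  have iC := (integrableOn_exp_neg_mul_mul hq hC hC0 fun s hs => (hCD s hs).trans (hD1 s hs)).mono_set
    (show {s : ℝ | 0 ≤ s ∧ (s : EReal) < ruinTime W U p x C ω} ⊆ _ from fun s hs => hs.1)
  have iD := (integrableOn_exp_neg_mul_mul hq hD (fun s hs => (hC0 s hs).trans (hCD s hs)) hD1).mono_set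
    (show {s : ℝ | 0 ≤ s ∧ (s : EReal) < ruinTime W U p x D ω} ⊆ _ from fun s hs => hs.1)
  have iA := ((integrableOn_exp_neg_mul_Ici hq 0).mono_set hA0).const_mul cbar
  rw [discountedDividends, discountedDividends, ← integral_const_mul,
    ← integral_indicator hSC, ← integral_indicator hSD, ← integral_indicator hA]
  have iD' := (integrable_indicator_iff hSD).2 iD
  have iA' := (integrable_indicator_iff hA).2 iA
  rw [← integral_add iD' iA']
  refine integral_mono ((integrable_indicator_iff hSC).2 iC) (iD'.add iA') fun s => ?_
  have hDnn : 0 ≤ ({s : ℝ | 0 ≤ s ∧ (s : EReal) < ruinTime W U p x D ω}).indicator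
      (fun s => Real.exp (-q * s) * D s ω) s :=
    Set.indicator_nonneg (fun s hs => mul_nonneg (Real.exp_pos _).le
      ((hC0 s hs.1).trans (hCD s hs.1))) s
  have hAnn : 0 ≤ A.indicator (fun s => cbar * Real.exp (-q * s)) s :=
    Set.indicator_nonneg (fun s _ => mul_nonneg hcbar (Real.exp_pos _).le) s
  simp only
  -- Where both strategies survive, `D` pays at least as much as `C`; on `A`, the rate of `C` is at
  -- most `cbar`.
  by_cases hs : s ∈ {s : ℝ | 0 ≤ s ∧ (s : EReal) < ruinTime W U p x C ω}
  · rw [Set.indicator_of_mem hs]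
    rcases hsub s hs.1 hs.2 with h | h
    · have hs' : s ∈ {s : ℝ | 0 ≤ s ∧ (s : EReal) < ruinTime W U p x D ω} := ⟨hs.1, h⟩
      rw [Set.indicator_of_mem hs'] at hDnn ⊢
      have := mul_le_mul_of_nonneg_left (hCD s hs.1) (Real.exp_pos (-q * s)).le
      linarith
    · rw [Set.indicator_of_mem h] at hAnn ⊢
      have := mul_le_mul_of_nonneg_left ((hCD s hs.1).trans (hD1 s hs.1)) (Real.exp_pos (-q * s)).le
      linarith
  · rw [Set.indicator_of_notMem hs]
    exact add_nonneg hDnn hAnn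

theorem discountedDividends_le (hq : 0 < q) (hC : MonotoneOn (fun t => C t ω) (Set.Ici 0))
    (hC0 : ∀ s, 0 ≤ s → 0 ≤ C s ω) (hC1 : ∀ s, 0 ≤ s → C s ω ≤ cbar) :
    discountedDividends W U p q x C ω ≤ cbar / q := by
  have iC := integrableOn_exp_neg_mul_mul hq hC hC0 hC1
  calc discountedDividends W U p q x C ω
      ≤ ∫ s in Set.Ici 0, Real.exp (-q * s) * C s ω := by
        refine setIntegral_mono_set iC ?_
          (Eventually.of_forall fun s (hs : s ∈ {s : ℝ | 0 ≤ s ∧ _}) => hs.1)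
        exact (ae_restrict_mem measurableSet_Ici).mono fun s hs =>
          mul_nonneg (Real.exp_pos _).le (hC0 s hs)
    _ ≤ ∫ s in Set.Ici 0, cbar * Real.exp (-q * s) := by
        refine setIntegral_mono_on iC ((integrableOn_exp_neg_mul_Ici hq 0).const_mul cbar)
          measurableSet_Ici fun s hs => ?_
        rw [mul_comm]
        exact mul_le_mul_of_nonneg_right (hC1 s hs) (Real.exp_pos _).le
    _ = cbar / q := by
        rw [integral_const_mul, integral_exp_neg_mul_Ici hq]
        simp [div_eq_mul_inv]

/-- The discount factor is at most `1` on the interval, and the tail integrates exactly. The two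
sets may overlap. -/
theorem integral_exp_neg_mul_Ico_union_Ici_le (hq : 0 < q) {a h T : ℝ} (ha : 0 ≤ a) (hh : 0 ≤ h) :
    ∫ s in Set.Ico a (a + h) ∪ Set.Ici T, Real.exp (-q * s) ≤ h + Real.exp (-q * T) / q := by
  have hT := integrableOn_exp_neg_mul_Ici hq T
  have ha' := (integrableOn_exp_neg_mul_Ici hq a).mono_set
    (show Set.Ico a (a + h) ⊆ Set.Ici a from Set.Ico_subset_Ici_self)
  have h1 : ∫ s in Set.Ico a (a + h), Real.exp (-q * s) ≤ h := by
    calc _ ≤ ∫ _ in Set.Ico a (a + h), (1 : ℝ) := by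
          refine setIntegral_mono_on ha' (by simp) measurableSet_Ico fun s hs => ?_
          rw [Real.exp_le_one_iff]
          nlinarith [hs.1]
      _ = h := by simp [hh]
  have h2 : ∫ s in Set.Ico a (a + h) ∪ Set.Ici T, Real.exp (-q * s) ≤
      (∫ s in Set.Ico a (a + h), Real.exp (-q * s)) + ∫ s in Set.Ici T, Real.exp (-q * s) := by
    rw [← Set.union_sdiff_self, setIntegral_union Set.disjoint_sdiff_right
      (measurableSet_Ici.diff measurableSet_Ico) ha' (hT.mono_set Set.sdiff_subset)]
    gcongr
    · exact Eventually.of_forall fun _ => (Real.exp_pos _).le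
    · exact Set.sdiff_subset
  rw [integral_exp_neg_mul_Ici hq] at h2
  linarith

/-- Either `D` survives until `T` and only the tail is lost, or `D` is ruined at some `a < T` and,
before `T`, `C` outlives it by at most `δ T / (c₁ - p)`. -/
theorem discountedDividends_le_of_drift_neg (hq : 0 < q) {δ c₁ T : ℝ} (h : IsRegularPath W U ω)
    (hC : MonotoneOn (fun t => C t ω) (Set.Ici 0)) (hD : MonotoneOn (fun t => D t ω) (Set.Ici 0))
    (hC0 : ∀ s, 0 ≤ s → 0 ≤ C s ω) (hCD : ∀ s, 0 ≤ s → C s ω ≤ D s ω)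
    (hD1 : ∀ s, 0 ≤ s → D s ω ≤ cbar)
    (hDC : ∀ t, 0 ≤ t → D t ω ≤ C t ω + δ) (hc : ∀ t, 0 ≤ t → c₁ ≤ C t ω) (hpc : p < c₁)
    (hδ : 0 ≤ δ) (hT : 0 ≤ T) :
    discountedDividends W U p q x C ω ≤ discountedDividends W U p q x D ω +
      cbar * (δ * T / (c₁ - p) + Real.exp (-q * T) / q) := by
  have hcbar : 0 ≤ cbar := (hC0 0 le_rfl).trans ((hCD 0 le_rfl).trans (hD1 0 le_rfl))
  have hq' : 0 ≤ δ * T / (c₁ - p) := div_nonneg (mul_nonneg hδ hT) (sub_pos.2 hpc).le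
  obtain ⟨a, ha0, ha⟩ : ∃ a : ℝ, 0 ≤ a ∧ ∀ s : ℝ, 0 ≤ s → (s : EReal) < ruinTime W U p x C ω →
      (s : EReal) < ruinTime W U p x D ω ∨
        s ∈ Set.Ico a (a + δ * T / (c₁ - p)) ∪ Set.Ici T := by
    rcases le_or_gt (T : EReal) (ruinTime W U p x D ω) with hτ | hτ
    · refine ⟨0, le_rfl, fun s _ _ => ?_⟩
      rcases lt_or_ge s T with hsT | hsT
      · exact Or.inl ((EReal.coe_lt_coe_iff.2 hsT).trans_le hτ)
      · exact Or.inr (Or.inr hsT)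
    · have h0 : (0 : EReal) ≤ ruinTime W U p x D ω := by
        refine le_sInf ?_
        rintro _ ⟨t, ht, rfl⟩
        exact EReal.coe_nonneg.2 ht.1
      obtain ⟨a, ha⟩ : ∃ a : ℝ, ruinTime W U p x D ω = a :=
        ⟨(ruinTime W U p x D ω).toReal, (EReal.coe_toReal (ne_top_of_lt hτ)
          (ne_of_gt (EReal.bot_lt_zero.trans_le h0))).symm⟩
      rw [ha] at hτ h0 ⊢
      refine ⟨a, by exact_mod_cast h0, fun s hs hsC => ?_⟩
      rcases lt_or_ge s a with hsa | hsa
      · exact Or.inl (EReal.coe_lt_coe_iff.2 hsa)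
      · refine Or.inr ?_
        rcases lt_or_ge s T with hsT | hsT
        · refine Or.inl ⟨hsa, ?_⟩
          by_contra hcon
          rw [not_lt] at hcon
          -- The surplus need not be negative at the infimum `a` itself. The slack `s' - s`, with
          -- `s'` still before ruin under `C`, leaves room for a time `r < a + (s' - s)` at which
          -- the surplus under `D` is negative.
          obtain ⟨s', hs's, hs'⟩ := EReal.lt_iff_exists_real_btwn.1 hsC
          have hs's : s < s' := EReal.coe_lt_coe_iff.1 hs's
          have hlt : ruinTime W U p x D ω < ((min T (a + (s' - s)) : ℝ) : EReal) := by
            rw [ha, EReal.coe_lt_coe_iff]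
            exact lt_min (EReal.coe_lt_coe_iff.1 hτ) (by linarith)
          obtain ⟨r, hr0, hr, hneg⟩ := exists_controlledSurplus_neg hlt
          have hr := EReal.coe_lt_coe_iff.1 hr
          have := survival_subset_of_drift_neg h hC hD hDC hc hpc hδ hr0
            (hr.trans_le (min_le_left _ _)) hneg hs'
          linarith [hr.trans_le (min_le_right _ _)]
        · exact Or.inr hsT
  refine (discountedDividends_le_add hq hC hD hC0 hCD hD1
    (measurableSet_Ico.union measurableSet_Ici) ?_ ha).trans ?_
  · exact Set.union_subset (fun s hs => ha0.trans hs.1) (Set.Ici_subset_Ici.2 hT)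
  · gcongr
    exact integral_exp_neg_mul_Ico_union_Ici_le hq ha0 hq'

theorem discountedDividends_le_of_drift_nonneg (hq : 0 < q) {δ T : ℝ} (hx : 0 ≤ x)
    (h : IsRegularPath W U ω)
    (hC : MonotoneOn (fun t => C t ω) (Set.Ici 0)) (hD : MonotoneOn (fun t => D t ω) (Set.Ici 0))
    (hC0 : ∀ s, 0 ≤ s → 0 ≤ C s ω) (hCD : ∀ s, 0 ≤ s → C s ω ≤ D s ω)
    (hD1 : ∀ s, 0 ≤ s → D s ω ≤ cbar)
    (hDC : ∀ t, 0 ≤ t → D t ω ≤ C t ω + δ) (hcp : cbar ≤ p) (hδ : 0 ≤ δ) (hT : 0 ≤ T)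
    (hgood : ∀ i, arrivalTime W i ω < T → claimCount W (arrivalTime W i ω) ω = i + 1 →
      controlledSurplus W U p x C (arrivalTime W i ω) ω ∉ Set.Ico 0 (δ * T)) :
    discountedDividends W U p q x C ω ≤ discountedDividends W U p q x D ω +
      cbar * (Real.exp (-q * T) / q) := by
  rw [← integral_exp_neg_mul_Ici hq]
  refine discountedDividends_le_add hq hC hD hC0 hCD hD1 measurableSet_Ici
    (Set.Ici_subset_Ici.2 hT) fun s hs hsC => ?_
  by_contra hcon
  push Not at hcon
  obtain ⟨hsD, hsT⟩ := hcon
  have hsT : s < T := not_le.1 hsT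
  obtain ⟨s', hs's, hs'⟩ := EReal.lt_iff_exists_real_btwn.1 hsC
  have hlt : ruinTime W U p x D ω < ((min T s' : ℝ) : EReal) :=
    hsD.trans_lt (EReal.coe_lt_coe_iff.2 (lt_min hsT (EReal.coe_lt_coe_iff.1 hs's)))
  obtain ⟨r, hr0, hr, hneg⟩ := exists_controlledSurplus_neg hlt
  have hr := EReal.coe_lt_coe_iff.1 hr
  obtain ⟨i, h1, h2, h3, h4⟩ := exists_small_surplus_of_drift_nonneg hx h hC hD hDC
    (fun t ht => (hD1 t ht).trans hcp) hδ hr0 (hr.trans_le (min_le_left _ _)) hneg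
    ((EReal.coe_le_coe_iff.2 (hr.le.trans (min_le_right _ _))).trans_lt hs')
  exact hgood i h1 h2 ⟨h3, h4⟩

end DiscountedDividends

/-! ### Joint measurability of strategies and integrability of the dividends. -/

section Measurability

/-- Replacing `s` by the next point of the lattice of mesh `1 / (n + 1)` to its right gives
approximants that involve only countably many times; right continuity makes them converge. -/
theorem measurable_uncurry_of_rightContinuous {α : Type*} [MeasurableSpace α] {f : ℝ → α → ℝ}
    (hm : ∀ t, Measurable (f t))
    (hc : ∀ a t, ContinuousWithinAt (fun s => f s a) (Set.Ici t) t) :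
    Measurable (Function.uncurry f) := by
  have hu : ∀ s : ℝ, Tendsto (fun n : ℕ => ((⌊((n : ℝ) + 1) * s⌋ : ℝ) + 1) / ((n : ℝ) + 1)) atTop
      (𝓝[≥] s) := by
    intro s
    have hlt : ∀ n : ℕ, s ≤ ((⌊((n : ℝ) + 1) * s⌋ : ℝ) + 1) / ((n : ℝ) + 1) := by
      intro n
      rw [le_div_iff₀ (by positivity), mul_comm]
      exact (Int.lt_floor_add_one _).le
    have hle : ∀ n : ℕ, ((⌊((n : ℝ) + 1) * s⌋ : ℝ) + 1) / ((n : ℝ) + 1) ≤ s + 1 / ((n : ℝ) + 1) := by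
      intro n
      have hn : (0 : ℝ) < (n : ℝ) + 1 := by positivity
      rw [div_le_iff₀ hn, add_mul s, one_div_mul_cancel hn.ne', mul_comm s]
      linarith [Int.floor_le (((n : ℝ) + 1) * s)]
    refine tendsto_nhdsWithin_iff.2 ⟨?_, Eventually.of_forall hlt⟩
    refine tendsto_of_tendsto_of_tendsto_of_le_of_le tendsto_const_nhds ?_ hlt hle
    simpa using (tendsto_one_div_add_atTop_nhds_zero_nat (𝕜 := ℝ)).const_add s
  refine measurable_of_tendsto_metrizable (f := fun (n : ℕ) (z : ℝ × α) =>
    f (((⌊((n : ℝ) + 1) * z.1⌋ : ℝ) + 1) / ((n : ℝ) + 1)) z.2) (fun n => ?_) ?_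
  · have h1 : Measurable fun z : ℤ × α => f (((z.1 : ℝ) + 1) / ((n : ℝ) + 1)) z.2 :=
      measurable_from_prod_countable_right fun k => hm (((k : ℝ) + 1) / ((n : ℝ) + 1))
    have h2 : Measurable fun z : ℝ × α => (⌊((n : ℝ) + 1) * z.1⌋, z.2) :=
      (Int.measurable_floor.comp (measurable_fst.const_mul _)).prodMk measurable_snd
    exact h1.comp h2
  · rw [tendsto_pi_nhds]
    intro z
    exact (hc z.2 z.1).tendsto.comp (hu z.1)

/-- `ℕ` has only countably many finite subsets, so any family of them is measurable. The fibre over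
`0` also contains the infinite sets and is handled through its complement. -/
theorem measurable_ncard_nat : Measurable (Set.ncard : Set ℕ → ℕ) := by
  refine measurable_to_countable' fun k => ?_
  have hfin : ∀ P : Set ℕ → Prop, MeasurableSet {s : Set ℕ | s.Finite ∧ P s} := fun P =>
    (Set.Countable.ofPred_finite.mono fun s hs => hs.1).measurableSet
  rcases Nat.eq_zero_or_pos k with rfl | hk
  · have : (Set.ncard ⁻¹' {0} : Set (Set ℕ)) = {s : Set ℕ | s.Finite ∧ s.ncard ≠ 0}ᶜ := by
      ext s
      by_cases hs : s.Finite
      · simp [hs]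
      · simp [hs, Set.Infinite.ncard hs]
    rw [this]
    exact (hfin _).compl
  · have : (Set.ncard ⁻¹' {k} : Set (Set ℕ)) = {s : Set ℕ | s.Finite ∧ s.ncard = k} := by
      ext s
      simp only [Set.mem_preimage, Set.mem_singleton_iff, Set.mem_ofPred_eq, iff_and_self]
      intro hs
      exact Set.finite_of_ncard_pos (hs ▸ hk)
    rw [this]
    exact hfin _

variable {Ω : Type*} [MeasurableSpace Ω] {μ : Measure Ω} {W U : ℕ → Ω → ℝ} {p q x cbar c : ℝ}
  {C : ℝ → Ω → ℝ}

theorem measurable_arrivalTime (hW : ∀ i, Measurable (W i)) (i : ℕ) :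
    Measurable (arrivalTime W i) := by
  unfold arrivalTime
  fun_prop

theorem measurable_claimCount (hW : ∀ i, Measurable (W i)) (t : ℝ) :
    Measurable (claimCount W t) := by
  refine measurable_ncard_nat.comp (measurable_set_iff.2 fun i => ?_)
  exact measurableSet_setOfPred.1 (measurableSet_le (measurable_arrivalTime hW i) measurable_const)

theorem measurable_surplus (hW : ∀ i, Measurable (W i)) (hU : ∀ i, Measurable (U i)) (t : ℝ) :
    Measurable (surplus W U p x t) := by
  have h1 : Measurable fun z : ℕ × Ω => ∑ i ∈ Finset.range z.1, U i z.2 :=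
    measurable_from_prod_countable_right fun k =>
      Finset.measurable_sum (Finset.range k) fun i _ => hU i
  exact measurable_const.sub (h1.comp ((measurable_claimCount hW t).prodMk measurable_id))

theorem surplusFiltration_le (hW : ∀ i, Measurable (W i)) (hU : ∀ i, Measurable (U i)) (t : ℝ) :
    surplusFiltration μ W U p t ≤ ‹MeasurableSpace Ω› := by
  refine sup_le (iSup₂_le fun s _ => (measurable_surplus hW hU s).comap_le) ?_
  exact MeasurableSpace.generateFrom_le fun A hA => hA.1

theorem IsAdmissible.measurable (hC : IsAdmissible μ W U p cbar c C)
    (hW : ∀ i, Measurable (W i)) (hU : ∀ i, Measurable (U i)) {t : ℝ} (ht : 0 ≤ t) :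
    Measurable (C t) :=
  (hC.adapted t ht).mono (surplusFiltration_le hW hU t) le_rfl

/-- The strategy frozen at its initial value at negative times is right continuous. -/
theorem IsAdmissible.rightContinuous_max (hC : IsAdmissible μ W U p cbar c C) (ω : Ω) (t : ℝ) :
    ContinuousWithinAt (fun s => C (max s 0) ω) (Set.Ici t) t := by
  refine ContinuousWithinAt.comp (t := Set.Ici (max t 0)) (g := fun s => C s ω)
    (hC.rightContinuous ω _ (le_max_right _ _)) ?_ ?_
  · fun_prop
  · exact fun s hs => Set.mem_Ici.2 (max_le_max_right 0 (Set.mem_Ici.1 hs))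

theorem IsAdmissible.measurable_uncurry (hC : IsAdmissible μ W U p cbar c C)
    (hW : ∀ i, Measurable (W i)) (hU : ∀ i, Measurable (U i)) :
    Measurable (Function.uncurry fun s => C (max s 0)) :=
  measurable_uncurry_of_rightContinuous (fun _ => hC.measurable hW hU (le_max_right _ _))
    hC.rightContinuous_max

theorem IsAdmissible.measurable_controlledSurplus (hC : IsAdmissible μ W U p cbar c C)
    (hW : ∀ i, Measurable (W i)) (hU : ∀ i, Measurable (U i)) {t : ℝ} (ht : 0 ≤ t) :
    Measurable (controlledSurplus W U p x C t) := by
  refine (measurable_surplus hW hU t).sub ?_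
  have h1 : (fun ω => ∫ s in (0 : ℝ)..t, C s ω) =
      fun ω => ∫ s in Set.Ioc 0 t, C (max s 0) ω := by
    funext ω
    rw [intervalIntegral.integral_of_le ht]
    exact setIntegral_congr_fun measurableSet_Ioc fun s hs => by simp [max_eq_left hs.1.le]
  rw [h1]
  exact ((hC.measurable_uncurry hW hU).stronglyMeasurable.integral_prod_left).measurable

-- By right continuity a negative surplus stays negative for a short while, hence at a rational
-- time. The countable infimum is what makes the ruin time measurable.
omit [MeasurableSpace Ω] in
theorem ruinTime_eq_iInf_rat {ω : Ω} (h : IsRegularPath W U ω)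
    (hC : MonotoneOn (fun t => C t ω) (Set.Ici 0)) :
    ruinTime W U p x C ω = ⨅ r : {r : ℚ // 0 ≤ r},
      if controlledSurplus W U p x C (r : ℝ) ω < 0 then ((r : ℝ) : EReal) else ⊤ := by
  refine le_antisymm (le_iInf fun r => ?_) (le_of_forall_gt fun a ha => ?_)
  · split_ifs with hr
    · exact sInf_le ⟨r, ⟨by exact_mod_cast r.2, hr⟩, rfl⟩
    · exact le_top
  · obtain ⟨t, ht0, hta, ht⟩ := exists_controlledSurplus_neg ha
    obtain ⟨b, htb, hba⟩ := EReal.lt_iff_exists_real_btwn.1 hta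
    have htb := EReal.coe_lt_coe_iff.1 htb
    have h1 := (controlledSurplus_rightContinuous (p := p) (x := x) h hC ht0).eventually
      (Iio_mem_nhds ht)
    obtain ⟨u, htu, hu⟩ := (mem_nhdsGE_iff_exists_Ico_subset' htb).1 h1
    obtain ⟨r, hr1, hr2⟩ := exists_rat_btwn (lt_min (Set.mem_Ioi.1 htu) htb)
    have hr0 : (0 : ℚ) ≤ r := by exact_mod_cast ht0.trans hr1.le
    refine (iInf_le _ (⟨r, hr0⟩ : {r : ℚ // 0 ≤ r})).trans_lt ?_
    have hneg : controlledSurplus W U p x C (r : ℝ) ω < 0 :=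
      hu ⟨hr1.le, hr2.trans_le (min_le_left _ _)⟩
    rw [if_pos hneg]
    exact (EReal.coe_lt_coe_iff.2 (hr2.trans_le (min_le_right _ _))).trans hba

/-- The infimum over rational times is measurable everywhere but is identified with the ruin time
only on regular paths, hence measurability up to a null set. -/
theorem IsAdmissible.aemeasurable_discountedDividends [SFinite μ]
    (hC : IsAdmissible μ W U p cbar c C)
    (hW : ∀ i, Measurable (W i)) (hU : ∀ i, Measurable (U i))
    (hreg : ∀ᵐ ω ∂μ, IsRegularPath W U ω) :
    AEMeasurable (discountedDividends W U p q x C) μ := by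
  set τ : Ω → EReal := fun ω => ⨅ r : {r : ℚ // 0 ≤ r},
      if controlledSurplus W U p x C (r : ℝ) ω < 0 then ((r : ℝ) : EReal) else ⊤
  have hτ : Measurable τ := by
    refine Measurable.iInf fun r => Measurable.ite ?_ measurable_const measurable_const
    exact hC.measurable_controlledSurplus hW hU (by exact_mod_cast r.2) measurableSet_Iio
  have hS : MeasurableSet {z : ℝ × Ω | 0 ≤ z.1 ∧ (z.1 : EReal) < τ z.2} :=
    (measurableSet_le measurable_const measurable_fst).inter
      (measurableSet_lt (measurable_coe_real_ereal.comp measurable_fst) (hτ.comp measurable_snd))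
  have hF : Measurable (({z : ℝ × Ω | 0 ≤ z.1 ∧ (z.1 : EReal) < τ z.2}).indicator
      fun z => Real.exp (-q * z.1) * C (max z.1 0) z.2) := by
    refine Measurable.indicator ?_ hS
    exact (by fun_prop : Measurable fun z : ℝ × Ω => Real.exp (-q * z.1)).mul
      (hC.measurable_uncurry hW hU)
  refine ⟨_, (hF.stronglyMeasurable.integral_prod_left' (μ := volume)).measurable, ?_⟩
  filter_upwards [hreg] with ω hω
  rw [discountedDividends, ← integral_indicator (measurableSet_survival _)]
  refine integral_congr_ae (Eventually.of_forall fun s => ?_)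
  simp only [Set.indicator, Set.mem_ofPred_eq, ruinTime_eq_iInf_rat hω (hC.monotone ω), τ]
  split_ifs with h1
  · rw [max_eq_left h1.1]
  · rfl

theorem IsAdmissible.integrable_discountedDividends [IsFiniteMeasure μ]
    (hC : IsAdmissible μ W U p cbar c C) (hc : 0 ≤ c) (hq : 0 < q)
    (hW : ∀ i, Measurable (W i)) (hU : ∀ i, Measurable (U i))
    (hreg : ∀ᵐ ω ∂μ, IsRegularPath W U ω) :
    Integrable (discountedDividends W U p q x C) μ := by
  refine Integrable.mono' (integrable_const (cbar / q))
    (hC.aemeasurable_discountedDividends hW hU hreg).aestronglyMeasurable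
    (Eventually.of_forall fun ω => ?_)
  have h0 : ∀ s, 0 ≤ s → 0 ≤ C s ω := fun s hs => hc.trans (hC.bounds ω s hs).1
  rw [Real.norm_of_nonneg (discountedDividends_nonneg h0)]
  exact discountedDividends_le hq (hC.monotone ω) h0 fun s hs => (hC.bounds ω s hs).2

end Measurability

/-! ### Almost every path is regular. -/

section Regularity

variable {Ω : Type*} [MeasurableSpace Ω] {μ : Measure Ω} {W U : ℕ → Ω → ℝ}

omit [MeasurableSpace Ω] in
theorem tendsto_arrivalTime_of_frequently {ω : Ω} (h0 : ∀ i, 0 ≤ W i ω)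
    (h1 : ∃ᶠ n in atTop, 1 < W n ω) : Tendsto (fun i => arrivalTime W i ω) atTop atTop := by
  have hmono : Monotone fun i => arrivalTime W i ω := by
    refine monotone_nat_of_le_succ fun i => ?_
    simp only [arrivalTime]
    rw [Finset.sum_range_succ _ (i + 1)]
    linarith [h0 (i + 1)]
  have key : ∀ k : ℕ, ∃ n, (k : ℝ) ≤ arrivalTime W n ω := by
    intro k
    induction k with
    | zero => exact ⟨0, by simpa [arrivalTime] using h0 0⟩
    | succ k ih =>
      obtain ⟨n, hn⟩ := ih
      obtain ⟨m, hm, hWm⟩ := frequently_atTop.1 h1 (n + 1)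
      obtain ⟨l, rfl⟩ : ∃ l, m = l + 1 := ⟨m - 1, by omega⟩
      refine ⟨l + 1, ?_⟩
      have h2 : arrivalTime W n ω ≤ arrivalTime W l ω := hmono (by omega)
      have h3 : arrivalTime W (l + 1) ω = arrivalTime W l ω + W (l + 1) ω := by
        simp only [arrivalTime]
        rw [Finset.sum_range_succ _ (l + 1)]
      push_cast
      linarith
  refine tendsto_atTop_atTop_of_monotone hmono fun b => ?_
  obtain ⟨k, hk⟩ := exists_nat_ge b
  obtain ⟨n, hn⟩ := key k
  exact ⟨n, hk.trans hn⟩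

/-- Explosion is excluded by the second Borel–Cantelli lemma: the events `W i > 1` are independent
with the same positive probability, so almost surely infinitely many occur. -/
theorem ae_isRegularPath [IsProbabilityMeasure μ] {β : ℝ} (hβ : 0 < β) {ν : Measure ℝ}
    (hν_nonneg : ν (Set.Iio 0) = 0)
    (hW_meas : ∀ i, Measurable (W i)) (hW_law : ∀ i, μ.map (W i) = expMeasure β)
    (hW_indep : iIndepFun W μ)
    (hU_meas : ∀ i, Measurable (U i)) (hU_law : ∀ i, μ.map (U i) = ν) :
    ∀ᵐ ω ∂μ, IsRegularPath W U ω := by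
  have := isProbabilityMeasure_expMeasure hβ
  have hexp : ∀ t : ℝ, 0 ≤ t → (expMeasure β).real (Set.Iic t) = 1 - Real.exp (-(β * t)) := by
    intro t ht
    rw [← cdf_eq_real, cdf_expMeasure_eq hβ, if_pos ht]
  have hW0 : ∀ᵐ ω ∂μ, ∀ i, 0 ≤ W i ω := by
    refine ae_all_iff.2 fun i => ?_
    have h0 : (expMeasure β) (Set.Iic 0) = 0 := by
      rw [← measureReal_eq_zero_iff, hexp 0 le_rfl]
      simp
    rw [← hW_law i, Measure.map_apply (hW_meas i) measurableSet_Iic] at h0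
    refine (measure_eq_zero_iff_ae_notMem.1 h0).mono fun ω hω => ?_
    exact (not_le.1 hω).le
  have hU0 : ∀ᵐ ω ∂μ, ∀ i, 0 ≤ U i ω := by
    refine ae_all_iff.2 fun i => ?_
    rw [← hU_law i, Measure.map_apply (hU_meas i) measurableSet_Iio] at hν_nonneg
    exact (measure_eq_zero_iff_ae_notMem.1 hν_nonneg).mono fun ω hω => not_lt.1 hω
  have hlim : μ (limsup (fun i => W i ⁻¹' Set.Ioi 1) atTop) = 1 := by
    refine measure_limsup_eq_one (fun i => hW_meas i measurableSet_Ioi) ?_ ?_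
    · rw [iIndepSet_iff_meas_biInter fun i => hW_meas i measurableSet_Ioi]
      exact fun s => hW_indep.measure_inter_preimage_eq_mul s fun i _ => measurableSet_Ioi
    · have hconst : ∀ i, μ (W i ⁻¹' Set.Ioi 1) = expMeasure β (Set.Ioi 1) := fun i => by
        rw [← hW_law i, Measure.map_apply (hW_meas i) measurableSet_Ioi]
      simp_rw [hconst]
      refine ENNReal.tsum_const_eq_top_of_ne_zero ?_
      rw [← Set.compl_Iic]
      intro h
      rw [prob_compl_eq_zero_iff measurableSet_Iic] at h
      have h1 := hexp 1 zero_le_one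
      rw [measureReal_def, h] at h1
      have := Real.exp_pos (-(β * 1))
      simp only [ENNReal.toReal_one] at h1
      linarith
  have hlim' : ∀ᵐ ω ∂μ, ω ∈ limsup (fun i => W i ⁻¹' Set.Ioi 1) atTop := by
    refine (prob_compl_eq_zero_iff ?_).2 hlim
    exact MeasurableSet.measurableSet_limsup fun i => hW_meas i measurableSet_Ioi
  filter_upwards [hW0, hU0, hlim'] with ω h1 h2 h3
  refine ⟨h1, h2, tendsto_arrivalTime_of_frequently h1 ?_⟩
  rwa [mem_limsup_iff_frequently_mem] at h3

end Regularity

/-! ### Each claim is independent of the surplus just before it. -/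

section Independence

/-- The joint law of the three variables is a triple product, which can be reassociated. -/
theorem IndepFun.prodMk_left_of_prodMk_right {Ω α β γ : Type*} [MeasurableSpace Ω]
    [MeasurableSpace α] [MeasurableSpace β] [MeasurableSpace γ] {μ : Measure Ω}
    [IsFiniteMeasure μ] {X : Ω → α} {Y : Ω → β} {Z : Ω → γ}
    (hX : Measurable X) (hY : Measurable Y) (hZ : Measurable Z)
    (h1 : IndepFun X (fun ω => (Y ω, Z ω)) μ) (h2 : IndepFun Y Z μ) :
    IndepFun (fun ω => (X ω, Y ω)) Z μ := by
  rw [indepFun_iff_map_prod_eq_prod_map_map (by fun_prop) (by fun_prop)] at h1 h2 ⊢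
  have h3 : IndepFun X Y μ := by
    have h1' := (indepFun_iff_map_prod_eq_prod_map_map (f := X) (g := fun ω => (Y ω, Z ω))
      (by fun_prop) (by fun_prop)).2 h1
    exact h1'.comp measurable_id measurable_fst
  rw [indepFun_iff_map_prod_eq_prod_map_map (by fun_prop) (by fun_prop)] at h3
  rw [h3]
  apply (MeasurableEquiv.prodAssoc).map_measurableEquiv_injective
  rw [Measure.prodAssoc_prod, ← h2, ← h1, Measure.map_map (by fun_prop) (by fun_prop)]
  rfl

/-- For a fixed value `y` of `Y` the event says that `V` lies in `(y - a, y]`, an increment of the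
distribution function of at most `K * a`; by Fubini this is averaged over `y`. -/
theorem measure_sub_mem_Ico_le {Ω : Type*} [MeasurableSpace Ω] {μ : Measure Ω}
    [IsProbabilityMeasure μ] {ν : Measure ℝ} [IsProbabilityMeasure ν] {K : NNReal}
    (hν : LipschitzWith K (cdf ν)) {Y V : Ω → ℝ} (hY : Measurable Y) (hV : Measurable V)
    (hlaw : μ.map V = ν) (hind : IndepFun Y V μ) {a : ℝ} (ha : 0 ≤ a) :
    μ {ω | Y ω - V ω ∈ Set.Ico 0 a} ≤ ENNReal.ofReal (K * a) := by
  have hmeas : MeasurableSet {z : ℝ × ℝ | z.1 - z.2 ∈ Set.Ico 0 a} :=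
    (measurable_fst.sub measurable_snd) measurableSet_Ico
  have h1 : μ {ω | Y ω - V ω ∈ Set.Ico 0 a} =
      (μ.map fun ω => (Y ω, V ω)) {z : ℝ × ℝ | z.1 - z.2 ∈ Set.Ico 0 a} :=
    (Measure.map_apply (hY.prodMk hV) hmeas).symm
  have : IsProbabilityMeasure (μ.map Y) := Measure.isProbabilityMeasure_map hY.aemeasurable
  rw [h1, (indepFun_iff_map_prod_eq_prod_map_map hY.aemeasurable hV.aemeasurable).1 hind, hlaw,
    Measure.prod_apply hmeas]
  calc _ ≤ ∫⁻ _, ENNReal.ofReal (K * a) ∂(μ.map Y) := by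
        refine lintegral_mono fun y => ?_
        have h2 : Prod.mk y ⁻¹' {z : ℝ × ℝ | z.1 - z.2 ∈ Set.Ico 0 a} = Set.Ioc (y - a) y := by
          ext u
          simp only [Set.mem_preimage, Set.mem_ofPred_eq, Set.mem_Ico, Set.mem_Ioc]
          constructor <;> rintro ⟨h, h'⟩ <;> constructor <;> linarith
        rw [h2, ← measure_cdf ν, StieltjesFunction.measure_Ioc]
        refine ENNReal.ofReal_le_ofReal ?_
        have h3 := hν.dist_le_mul y (y - a)
        rw [Real.dist_eq, Real.dist_eq, sub_sub_cancel, abs_of_nonneg ha] at h3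
        exact (le_abs_self _).trans h3
    _ = ENNReal.ofReal (K * a) := by simp

variable {Ω : Type*} [MeasurableSpace Ω] {μ : Measure Ω} {W U : ℕ → Ω → ℝ} {p q x cbar c : ℝ}
  {C : ℝ → Ω → ℝ}

/-- The σ-algebra of all waiting times and of the claims before claim `i`. -/
@[reducible] def arrivalSpace {Ω : Type*} (W U : ℕ → Ω → ℝ) (i : ℕ) : MeasurableSpace Ω :=
  MeasurableSpace.comap
    (fun ω => ((fun j => W j ω : ℕ → ℝ), (fun j => U j ω : Finset.range i → ℝ))) inferInstance

/-- The measurable sets which agree almost surely with a set in `arrivalSpace W U i`. -/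
@[reducible] def preClaimSpace {Ω : Type*} [MeasurableSpace Ω] (μ : Measure Ω) (W U : ℕ → Ω → ℝ)
    (i : ℕ) : MeasurableSpace Ω :=
  eventuallyMeasurableSpace (arrivalSpace W U i) (ae μ) ⊓ ‹MeasurableSpace Ω›

omit [MeasurableSpace Ω] in
theorem measurable_waiting_arrivalSpace (i j : ℕ) : Measurable[arrivalSpace W U i] (W j) :=
  ((measurable_pi_apply j).comp measurable_fst).comp (comap_measurable
    (fun ω => ((fun j => W j ω : ℕ → ℝ), (fun j => U j ω : Finset.range i → ℝ))))

omit [MeasurableSpace Ω] in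
theorem measurable_claim_arrivalSpace {i j : ℕ} (hj : j < i) :
    Measurable[arrivalSpace W U i] (U j) :=
  ((measurable_pi_apply (⟨j, Finset.mem_range.2 hj⟩ : Finset.range i)).comp
    measurable_snd).comp (comap_measurable
    (fun ω => ((fun j => W j ω : ℕ → ℝ), (fun j => U j ω : Finset.range i → ℝ))))

omit [MeasurableSpace Ω] in
theorem measurable_arrivalTime_arrivalSpace (i j : ℕ) :
    Measurable[arrivalSpace W U i] (arrivalTime W j) :=
  @measurable_arrivalTime Ω (arrivalSpace W U i) W (measurable_waiting_arrivalSpace i) j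

theorem arrivalSpace_le (hW : ∀ i, Measurable (W i)) (hU : ∀ i, Measurable (U i)) (i : ℕ) :
    arrivalSpace W U i ≤ ‹MeasurableSpace Ω› :=
  Measurable.comap_le (by fun_prop)

theorem arrivalSpace_le_preClaimSpace (hW : ∀ i, Measurable (W i)) (hU : ∀ i, Measurable (U i))
    (i : ℕ) : arrivalSpace W U i ≤ preClaimSpace μ W U i :=
  le_inf le_eventuallyMeasurableSpace (arrivalSpace_le hW hU i)

/-- The waiting times are independent of all claims, and the earlier claims of `U i`; changing
events by null sets does not affect independence. -/
theorem indep_preClaimSpace [IsProbabilityMeasure μ]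
    (hW : ∀ i, Measurable (W i)) (hU : ∀ i, Measurable (U i)) (hU_indep : iIndepFun U μ)
    (hWU_indep : IndepFun (fun ω i => W i ω) (fun ω i => U i ω) μ) (i : ℕ) :
    Indep (preClaimSpace μ W U i) (MeasurableSpace.comap (U i) inferInstance) μ := by
  have h1 : IndepFun (fun ω => (fun j => U j ω : Finset.range i → ℝ)) (U i) μ :=
    (hU_indep.indepFun_finset (Finset.range i) {i} (by simp) hU).comp measurable_id
      (measurable_pi_apply (⟨i, by simp⟩ : ({i} : Finset ℕ)))
  have h2 : IndepFun (fun ω j => W j ω)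
      (fun ω => ((fun j => U j ω : Finset.range i → ℝ), U i ω)) μ :=
    hWU_indep.comp measurable_id
      (by fun_prop : Measurable fun u : ℕ → ℝ => ((fun j => u j : Finset.range i → ℝ), u i))
  have h3 : IndepFun (fun ω => ((fun j => W j ω : ℕ → ℝ), (fun j => U j ω : Finset.range i → ℝ)))
      (U i) μ :=
    IndepFun.prodMk_left_of_prodMk_right (by fun_prop) (by fun_prop) (hU i) h2 h1
  have h4 : Indep (arrivalSpace W U i) (MeasurableSpace.comap (U i) inferInstance) μ := h3
  rw [Indep_iff] at h4 ⊢
  intro A B hA hB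
  obtain ⟨⟨A', hA', hAA'⟩, -⟩ := MeasurableSpace.measurableSet_inf.1 hA
  rw [measure_congr (hAA'.inter (EventuallyEq.refl _ B)), h4 A' B hA' hB, measure_congr hAA']

/-- The sets whose trace on `E` is measurable. -/
@[reducible] def traceSpace {Ω : Type*} (m : MeasurableSpace Ω) {E : Set Ω}
    (hE : MeasurableSet[m] E) : MeasurableSpace Ω where
  MeasurableSet' A := MeasurableSet[m] (A ∩ E)
  measurableSet_empty := by
    rw [Set.empty_inter]
    exact MeasurableSet.empty
  measurableSet_compl A hA := by
    have h : Aᶜ ∩ E = E \ (A ∩ E) := by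
      ext ω
      simp only [Set.mem_inter_iff, Set.mem_compl_iff, Set.mem_sdiff]
      tauto
    rw [h]
    exact hE.diff hA
  measurableSet_iUnion f hf := by
    rw [Set.iUnion_inter]
    exact MeasurableSet.iUnion hf

/-- Before the arrival of claim `i`, the information generated by the surplus only involves the
waiting times and the previous claims. -/
theorem measurableSet_inter_lt_arrivalTime (hW : ∀ i, Measurable (W i))
    (hU : ∀ i, Measurable (U i)) (hreg : ∀ᵐ ω ∂μ, IsRegularPath W U ω) (i : ℕ) {t : ℝ}
    {A : Set Ω} (hA : MeasurableSet[surplusFiltration μ W U p t] A) :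
    MeasurableSet[preClaimSpace μ W U i] (A ∩ {ω | t < arrivalTime W i ω}) := by
  set E : Set Ω := {ω | t < arrivalTime W i ω}
  have hE : MeasurableSet[arrivalSpace W U i] E :=
    measurable_arrivalTime_arrivalSpace i i measurableSet_Ioi
  have hE' := arrivalSpace_le_preClaimSpace (μ := μ) hW hU i _ hE
  -- Sets with a measurable trace on `E` form a σ-algebra, so only the generators need checking: the
  -- surplus at times `s ≤ t`, and the null events.
  suffices h : surplusFiltration μ W U p t ≤ traceSpace _ hE' from h A hA
  refine sup_le (iSup₂_le fun s hs => ?_) (MeasurableSpace.generateFrom_le fun A hA => ?_)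
  · rintro _ ⟨B, hB, rfl⟩
    refine MeasurableSpace.measurableSet_inf.2
      ⟨?_, (measurable_surplus hW hU s hB).inter (arrivalSpace_le hW hU i _ hE)⟩
    set g : Ω → ℝ := fun ω => 0 + p * s -
      ∑ j ∈ Finset.range i, if arrivalTime W j ω ≤ s then U j ω else 0
    have hg : Measurable[arrivalSpace W U i] g := by
      refine Measurable.const_sub (m := arrivalSpace W U i) ?_ _
      refine @Finset.measurable_sum _ _ _ _ _ _ (arrivalSpace W U i) _ _ fun j hj => ?_
      exact Measurable.ite (m := arrivalSpace W U i) (f := U j) (g := fun _ => 0)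
        (p := fun ω => arrivalTime W j ω ≤ s)
        (measurable_arrivalTime_arrivalSpace i j measurableSet_Iic)
        (measurable_claim_arrivalSpace (Finset.mem_range.1 hj)) measurable_const
    refine ⟨g ⁻¹' B ∩ E, @MeasurableSet.inter _ (arrivalSpace W U i) _ _ (hg hB) hE, ?_⟩
    refine eventuallyEq_set.2 (hreg.mono fun ω hω => ?_)
    simp only [Set.mem_inter_iff, Set.mem_preimage]
    refine and_congr_left fun hωE => ?_
    rw [hω.surplus_eq_of_lt_arrivalTime (hs.2.trans_lt hωE)]
  · have h0 : μ (A ∩ E) = 0 := measure_mono_null Set.inter_subset_left hA.2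
    refine MeasurableSpace.measurableSet_inf.2
      ⟨⟨∅, @MeasurableSet.empty _ (arrivalSpace W U i), ?_⟩, hA.1.inter (arrivalSpace_le hW hU i _ hE)⟩
    exact ae_eq_empty.2 h0

theorem IsAdmissible.measurable_indicator_lt_arrivalTime (hC : IsAdmissible μ W U p cbar c C)
    (hW : ∀ i, Measurable (W i)) (hU : ∀ i, Measurable (U i))
    (hreg : ∀ᵐ ω ∂μ, IsRegularPath W U ω) (i : ℕ) {t : ℝ} (ht : 0 ≤ t) :
    Measurable[preClaimSpace μ W U i] ({ω | t < arrivalTime W i ω}.indicator (C t)) := by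
  intro B hB
  have hE : MeasurableSet[preClaimSpace μ W U i] {ω | t < arrivalTime W i ω} := by
    simpa using measurableSet_inter_lt_arrivalTime (p := p) hW hU hreg i (t := t)
      MeasurableSet.univ
  rw [Set.indicator_preimage, Set.ite]
  refine MeasurableSet.union
    (measurableSet_inter_lt_arrivalTime hW hU hreg i (hC.adapted t ht hB)) (MeasurableSet.diff ?_ hE)
  exact (measurable_const : Measurable[preClaimSpace μ W U i] fun _ => (0 : ℝ)) hB

theorem measurable_integral_of_rightContinuous {α : Type*} [MeasurableSpace α] {f : ℝ → α → ℝ}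
    (hm : ∀ t, Measurable (f t))
    (hc : ∀ a t, ContinuousWithinAt (fun s => f s a) (Set.Ici t) t) (ν : Measure ℝ) [SFinite ν] :
    Measurable fun a => ∫ s, f s a ∂ν :=
  (measurable_uncurry_of_rightContinuous hm hc).stronglyMeasurable.integral_prod_left.measurable

/-- The controlled surplus right before claim `i`. -/
noncomputable def preClaimSurplus {Ω : Type*} (W U : ℕ → Ω → ℝ) (p x : ℝ) (C : ℝ → Ω → ℝ) (i : ℕ)
    (ω : Ω) : ℝ :=
  x + p * arrivalTime W i ω - ∑ j ∈ Finset.range i, U j ω -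
    ∫ s in Set.Ioi (0 : ℝ), {ω | max s 0 < arrivalTime W i ω}.indicator (C (max s 0)) ω

omit [MeasurableSpace Ω] in
theorem controlledSurplus_arrivalTime {ω : Ω} (h : IsRegularPath W U ω) {i : ℕ}
    (hi : claimCount W (arrivalTime W i ω) ω = i + 1) :
    controlledSurplus W U p x C (arrivalTime W i ω) ω = preClaimSurplus W U p x C i ω - U i ω := by
  have h1 : ∫ s in Set.Ioi (0 : ℝ), {ω | max s 0 < arrivalTime W i ω}.indicator (C (max s 0)) ω =
      ∫ s in (0 : ℝ)..arrivalTime W i ω, C s ω := by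
    rw [intervalIntegral.integral_of_le (h.arrivalTime_nonneg i), integral_Ioc_eq_integral_Ioo,
      ← Set.Ioi_inter_Iio, ← setIntegral_indicator measurableSet_Iio]
    refine setIntegral_congr_fun measurableSet_Ioi fun s hs => ?_
    simp only [Set.indicator, Set.mem_ofPred_eq, Set.mem_Iio, max_eq_left (le_of_lt (Set.mem_Ioi.1 hs))]
  rw [controlledSurplus, surplus, hi, preClaimSurplus, h1, Finset.sum_range_succ]
  ring

/-- Cutting the strategy off at the arrival of claim `i` leaves only information available before
that claim. The cut-off strategy is still right continuous, so its time integral inherits the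
measurability. -/
theorem IsAdmissible.measurable_preClaimSurplus (hC : IsAdmissible μ W U p cbar c C)
    (hW : ∀ i, Measurable (W i)) (hU : ∀ i, Measurable (U i))
    (hreg : ∀ᵐ ω ∂μ, IsRegularPath W U ω) (i : ℕ) :
    Measurable[preClaimSpace μ W U i] (preClaimSurplus W U p x C i) := by
  have hle := arrivalSpace_le_preClaimSpace (μ := μ) hW hU i
  have hint := @measurable_integral_of_rightContinuous Ω (preClaimSpace μ W U i)
    (fun s => {ω | max s 0 < arrivalTime W i ω}.indicator (C (max s 0)))
    (fun s => hC.measurable_indicator_lt_arrivalTime hW hU hreg i (le_max_right _ _))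
    (fun ω t => by
      rcases lt_or_ge (max t 0) (arrivalTime W i ω) with ht | ht
      · refine (hC.rightContinuous_max ω t).congr_of_eventuallyEq ?_ ?_
        · have hcont : ContinuousAt (fun s : ℝ => max s 0) t := by fun_prop
          filter_upwards [mem_nhdsWithin_of_mem_nhds (hcont (Iio_mem_nhds ht))] with s hs
          exact Set.indicator_of_mem (s := {ω | max s 0 < arrivalTime W i ω}) hs _
        · exact Set.indicator_of_mem (s := {ω | max t 0 < arrivalTime W i ω}) ht _
      · refine (continuousWithinAt_const (b := (0 : ℝ))).congr (fun s hs => ?_) ?_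
        · exact Set.indicator_of_notMem (s := {ω | max s 0 < arrivalTime W i ω})
            (not_lt.2 (ht.trans (max_le_max_right 0 hs))) _
        · exact Set.indicator_of_notMem (s := {ω | max t 0 < arrivalTime W i ω}) (not_lt.2 ht) _)
    (volume.restrict (Set.Ioi 0)) inferInstance
  have hT := (measurable_arrivalTime_arrivalSpace (W := W) (U := U) i i).mono hle le_rfl
  have hsum : Measurable[preClaimSpace μ W U i] fun ω => ∑ j ∈ Finset.range i, U j ω :=
    @Finset.measurable_sum _ _ _ _ _ _ (preClaimSpace μ W U i) _ _ fun j hj =>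
      (measurable_claim_arrivalSpace (Finset.mem_range.1 hj)).mono hle le_rfl
  exact ((hT.const_mul p).const_add x |>.sub hsum).sub hint

theorem IsAdmissible.measure_small_surplus_le [IsProbabilityMeasure μ] {ν : Measure ℝ}
    [IsProbabilityMeasure ν] {K : NNReal} (hν : LipschitzWith K (cdf ν))
    (hC : IsAdmissible μ W U p cbar c C)
    (hW : ∀ i, Measurable (W i)) (hU : ∀ i, Measurable (U i)) (hU_law : ∀ i, μ.map (U i) = ν)
    (hU_indep : iIndepFun U μ)
    (hWU_indep : IndepFun (fun ω i => W i ω) (fun ω i => U i ω) μ)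
    (hreg : ∀ᵐ ω ∂μ, IsRegularPath W U ω) (i : ℕ) {a : ℝ} (ha : 0 ≤ a) :
    μ {ω | preClaimSurplus W U p x C i ω - U i ω ∈ Set.Ico 0 a} ≤ ENNReal.ofReal (K * a) := by
  have hY := hC.measurable_preClaimSurplus (x := x) hW hU hreg i
  refine measure_sub_mem_Ico_le hν (hY.mono inf_le_right le_rfl) (hU i) (hU_law i) ?_ ha
  exact indep_of_indep_of_le_left (indep_preClaimSpace hW hU hU_indep hWU_indep i) hY.comap_le

end Independence

/-! ### Rounding dividend rates up to the dyadic grid. -/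

section Grid

/-- Rounding up to the next multiple of `cbar / 2 ^ n`. -/
noncomputable def ceilGrid (cbar : ℝ) (n : ℕ) (g : ℝ) : ℝ := (⌈g / cbar * 2 ^ n⌉₊ : ℝ) / 2 ^ n * cbar

variable {p cbar g : ℝ}

theorem ceilGrid_monotone (hcbar : 0 < cbar) (n : ℕ) : Monotone (ceilGrid cbar n) := by
  intro g h hgh
  unfold ceilGrid
  gcongr

theorem le_ceilGrid (hcbar : 0 < cbar) (n : ℕ) (g : ℝ) : g ≤ ceilGrid cbar n g := by
  unfold ceilGrid
  rw [← div_le_iff₀ hcbar, le_div_iff₀ (by positivity)]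
  exact Nat.le_ceil _

theorem ceilGrid_le_add (hcbar : 0 < cbar) (n : ℕ) (hg : 0 ≤ g) :
    ceilGrid cbar n g ≤ g + cbar / 2 ^ n := by
  unfold ceilGrid
  have h := (Nat.ceil_lt_add_one (show 0 ≤ g / cbar * 2 ^ n by positivity)).le
  calc (⌈g / cbar * 2 ^ n⌉₊ : ℝ) / 2 ^ n * cbar ≤ (g / cbar * 2 ^ n + 1) / 2 ^ n * cbar := by gcongr
    _ = g + cbar / 2 ^ n := by field_simp

theorem ceilGrid_eq (hcbar : 0 < cbar) (n : ℕ) (hg : g ≤ cbar) :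
    ∃ k : ℕ, k ≤ 2 ^ n ∧ ceilGrid cbar n g = (k : ℝ) / 2 ^ n * cbar := by
  refine ⟨_, ?_, rfl⟩
  rw [Nat.ceil_le]
  push_cast
  exact mul_le_of_le_one_left (by positivity) ((div_le_one hcbar).2 hg)

theorem ceilGrid_le (hcbar : 0 < cbar) (n : ℕ) (hg : g ≤ cbar) : ceilGrid cbar n g ≤ cbar := by
  obtain ⟨k, hk, h⟩ := ceilGrid_eq hcbar n hg
  rw [h]
  refine mul_le_of_le_one_left hcbar.le ((div_le_one (by positivity)).2 ?_)
  exact_mod_cast hk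

theorem ceilGrid_mem_dyadicGrid (hcbar : 0 < cbar) (n : ℕ) (hg : g ≤ cbar) :
    ceilGrid cbar n g ∈ dyadicGrid p cbar n :=
  Or.inl (ceilGrid_eq hcbar n hg)

theorem finite_dyadicGrid (p cbar : ℝ) (n : ℕ) : (dyadicGrid p cbar n).Finite := by
  refine (((Set.finite_Iic (2 ^ n)).image fun k : ℕ => (k : ℝ) / 2 ^ n * cbar).union
    (Set.finite_singleton p)).subset ?_
  rintro g (⟨k, hk, rfl⟩ | ⟨-, rfl⟩)
  · exact Or.inl ⟨k, hk, rfl⟩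
  · exact Or.inr rfl

theorem dyadicGrid_mono (p cbar : ℝ) : Monotone (dyadicGrid p cbar) := by
  refine monotone_nat_of_le_succ fun n => ?_
  rintro g (⟨k, hk, rfl⟩ | h)
  · refine Or.inl ⟨k * 2, ?_, ?_⟩
    · rw [pow_succ]
      omega
    · push_cast
      rw [pow_succ, mul_div_mul_right _ _ two_ne_zero]
  · exact Or.inr h

theorem cbar_mem_dyadicGrid (p cbar : ℝ) (n : ℕ) : cbar ∈ dyadicGrid p cbar n :=
  Or.inl ⟨2 ^ n, le_rfl, by simp⟩

end Grid

/-! ### Cost of rounding, and convergence of the value functions. -/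

section Values

variable {Ω : Type*} [MeasurableSpace Ω] {μ : Measure Ω} {W U : ℕ → Ω → ℝ} {p q x cbar c : ℝ}
  {C : ℝ → Ω → ℝ}

/-- A monotone function of a finitely valued strategy is again right continuous. -/
theorem IsAdmissible.ceilGrid (hcbar : 0 < cbar) (hC : IsAdmissible μ W U p cbar c C) {m : ℕ}
    (hG : ∀ ω : Ω, ∀ t : ℝ, 0 ≤ t → C t ω ∈ dyadicGrid p cbar m) (n : ℕ) :
    IsAdmissible μ W U p cbar c fun t ω => ceilGrid cbar n (C t ω) where
  adapted t ht := (ceilGrid_monotone hcbar n).measurable.comp (hC.adapted t ht)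
  monotone ω := fun _ hs _ ht hst => ceilGrid_monotone hcbar n (hC.monotone ω hs ht hst)
  rightContinuous ω t ht := by
    -- Rounding up is not right continuous. But `C` takes finitely many values, so right continuity
    -- makes it constant on a short interval to the right of `t`.
    have hfin : (dyadicGrid p cbar m \ {C t ω}).Finite := (finite_dyadicGrid p cbar m).sdiff
    have h1 := (hC.rightContinuous ω t ht).eventually
      (hfin.isClosed.isOpen_compl.mem_nhds (fun h => h.2 rfl))
    refine (continuousWithinAt_const (b := Ratcheting.ceilGrid cbar n (C t ω))).congr_of_eventuallyEq
      ?_ rfl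
    filter_upwards [h1, self_mem_nhdsWithin] with s hs hts
    have : C s ω = C t ω := by
      by_contra hne
      exact hs ⟨hG ω s (ht.trans hts), hne⟩
    simp only [this]
  bounds ω t ht := ⟨(hC.bounds ω t ht).1.trans (le_ceilGrid hcbar n _),
    ceilGrid_le hcbar n (hC.bounds ω t ht).2⟩

/-- The strategies over which the supremum in `Vn` is taken. -/
def gridStrategies {Ω : Type*} [MeasurableSpace Ω] (μ : Measure Ω) (W U : ℕ → Ω → ℝ)
    (p cbar : ℝ) (n : ℕ) (c : ℝ) : Set (ℝ → Ω → ℝ) :=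
  {C | IsAdmissible μ W U p cbar c C ∧
    ∀ ω : Ω, ∀ t : ℝ, 0 ≤ t → C t ω ∈ dyadicGrid p cbar n}

theorem gridStrategies_nonempty (hc : c ≤ cbar) (n : ℕ) :
    (gridStrategies μ W U p cbar n c).Nonempty :=
  ⟨fun _ _ => cbar,
    { adapted := fun _ _ => measurable_const
      monotone := fun _ => monotoneOn_const
      rightContinuous := fun _ _ _ => continuousWithinAt_const
      bounds := fun _ _ _ => ⟨hc, le_rfl⟩ }, fun _ _ _ => cbar_mem_dyadicGrid p cbar n⟩

theorem ceilGrid_mem_gridStrategies (hcbar : 0 < cbar) {m : ℕ}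
    (hC : C ∈ gridStrategies μ W U p cbar m c) (n : ℕ) :
    (fun t ω => ceilGrid cbar n (C t ω)) ∈ gridStrategies μ W U p cbar n c :=
  ⟨hC.1.ceilGrid hcbar hC.2 n, fun ω t ht =>
    ceilGrid_mem_dyadicGrid hcbar n (hC.1.bounds ω t ht).2⟩

variable [IsProbabilityMeasure μ]

theorem IsAdmissible.payoff_le (hC : IsAdmissible μ W U p cbar c C) (hc : 0 ≤ c) (hq : 0 < q)
    (hW : ∀ i, Measurable (W i)) (hU : ∀ i, Measurable (U i))
    (hreg : ∀ᵐ ω ∂μ, IsRegularPath W U ω) : payoff μ W U p q x C ≤ cbar / q := by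
  rw [payoff_eq_integral_discountedDividends]
  calc _ ≤ ∫ _, cbar / q ∂μ := by
        refine integral_mono (hC.integrable_discountedDividends hc hq hW hU hreg)
          (integrable_const _) fun ω => ?_
        exact discountedDividends_le hq (hC.monotone ω)
          (fun s hs => hc.trans (hC.bounds ω s hs).1) fun s hs => (hC.bounds ω s hs).2
    _ = cbar / q := by simp

theorem bddAbove_payoff (hc : 0 ≤ c) (hq : 0 < q)
    (hW : ∀ i, Measurable (W i)) (hU : ∀ i, Measurable (U i))
    (hreg : ∀ᵐ ω ∂μ, IsRegularPath W U ω) (n : ℕ) :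
    BddAbove (payoff μ W U p q x '' gridStrategies μ W U p cbar n c) := by
  refine ⟨cbar / q, ?_⟩
  rintro _ ⟨C, hC, rfl⟩
  exact hC.1.payoff_le hc hq hW hU hreg

theorem Vn_mono (hc : 0 ≤ c) (hc' : c ≤ cbar) (hq : 0 < q)
    (hW : ∀ i, Measurable (W i)) (hU : ∀ i, Measurable (U i))
    (hreg : ∀ᵐ ω ∂μ, IsRegularPath W U ω) : Monotone fun n => Vn μ W U p q cbar n x c := by
  intro n m hnm
  refine csSup_le_csSup (bddAbove_payoff hc hq hW hU hreg m)
    ((gridStrategies_nonempty hc' n).image _) (Set.image_mono fun C hC => ?_)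
  exact ⟨hC.1, fun ω t ht => dyadicGrid_mono p cbar hnm (hC.2 ω t ht)⟩

theorem tendsto_Vn (hc : 0 ≤ c) (hc' : c ≤ cbar) (hq : 0 < q)
    (hW : ∀ i, Measurable (W i)) (hU : ∀ i, Measurable (U i))
    (hreg : ∀ᵐ ω ∂μ, IsRegularPath W U ω) :
    Tendsto (fun n : ℕ => Vn μ W U p q cbar n x c) atTop (𝓝 (Vbar μ W U p q cbar x c)) := by
  refine tendsto_nhds_limUnder ⟨_, tendsto_atTop_ciSup (Vn_mono hc hc' hq hW hU hreg) ?_⟩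
  refine ⟨cbar / q, ?_⟩
  rintro _ ⟨n, rfl⟩
  refine csSup_le ((gridStrategies_nonempty hc' n).image _) ?_
  rintro _ ⟨C, hC, rfl⟩
  exact IsAdmissible.payoff_le hC.1 hc hq hW hU hreg

/-- If rounding up a strategy costs at most a uniformly small amount, then the convergence is
uniform. -/
theorem tendstoUniformlyOn_Vn (hcbar : 0 < cbar) (hq : 0 < q)
    (hW : ∀ i, Measurable (W i)) (hU : ∀ i, Measurable (U i))
    (hreg : ∀ᵐ ω ∂μ, IsRegularPath W U ω) {c₁ : ℝ} (hc₁ : 0 ≤ c₁)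
    (h : ∀ ε : ℝ, 0 < ε → ∀ᶠ n in atTop, ∀ m : ℕ, ∀ x, 0 ≤ x → ∀ c, c₁ ≤ c →
      ∀ C ∈ gridStrategies μ W U p cbar m c,
        payoff μ W U p q x C ≤ payoff μ W U p q x (fun t ω => ceilGrid cbar n (C t ω)) + ε) :
    TendstoUniformlyOn (fun (n : ℕ) (z : ℝ × ℝ) => Vn μ W U p q cbar n z.1 z.2)
      (fun z : ℝ × ℝ => Vbar μ W U p q cbar z.1 z.2) atTop (Set.Ici 0 ×ˢ Set.Icc c₁ cbar) := by
  rw [Metric.tendstoUniformlyOn_iff]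
  intro ε hε
  filter_upwards [h (ε / 2) (half_pos hε)] with n hn
  rintro ⟨x, c⟩ ⟨hx, hc⟩
  simp only
  have hc0 : 0 ≤ c := hc₁.trans hc.1
  have hlim := tendsto_Vn (x := x) (p := p) hc0 hc.2 hq hW hU hreg
  have h1 : Vn μ W U p q cbar n x c ≤ Vbar μ W U p q cbar x c :=
    (Vn_mono hc0 hc.2 hq hW hU hreg).ge_of_tendsto hlim n
  have h2 : Vbar μ W U p q cbar x c ≤ Vn μ W U p q cbar n x c + ε / 2 := by
    -- The choice of `n` does not depend on `m`, so the bound holds for every `Vn` of index `m` and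
    -- passes to the limit.
    refine le_of_tendsto' hlim fun m => ?_
    refine csSup_le ((gridStrategies_nonempty hc.2 m).image _) ?_
    rintro _ ⟨C, hC, rfl⟩
    refine (hn m x hx c hc.1 C hC).trans ?_
    gcongr
    exact le_csSup (bddAbove_payoff hc0 hq hW hU hreg n)
      ⟨_, ceilGrid_mem_gridStrategies hcbar hC n, rfl⟩
  rw [Real.dist_eq, abs_of_nonneg (by linarith)]
  linarith

theorem payoff_le_ceilGrid_of_drift_neg (hcbar : 0 < cbar) (hq : 0 < q)
    (hW : ∀ i, Measurable (W i)) (hU : ∀ i, Measurable (U i))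
    (hreg : ∀ᵐ ω ∂μ, IsRegularPath W U ω) {c₁ T : ℝ} (hc₁ : 0 ≤ c₁) (hpc : p < c₁) (hT : 0 ≤ T)
    (hc : c₁ ≤ c) {m : ℕ} (hC : C ∈ gridStrategies μ W U p cbar m c) (n : ℕ) :
    payoff μ W U p q x C ≤ payoff μ W U p q x (fun t ω => ceilGrid cbar n (C t ω)) +
      cbar * (cbar / 2 ^ n * T / (c₁ - p) + Real.exp (-q * T) / q) := by
  have hc0 := hc₁.trans hc
  have hD := ceilGrid_mem_gridStrategies hcbar hC n
  have iC := hC.1.integrable_discountedDividends (x := x) hc0 hq hW hU hreg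
  have iD := hD.1.integrable_discountedDividends (x := x) hc0 hq hW hU hreg
  rw [payoff_eq_integral_discountedDividends, payoff_eq_integral_discountedDividends]
  have h0 : ∀ ω s, 0 ≤ s → 0 ≤ C s ω := fun ω s hs => hc0.trans (hC.1.bounds ω s hs).1
  refine (integral_mono_ae iC (iD.add (integrable_const
    (cbar * (cbar / 2 ^ n * T / (c₁ - p) + Real.exp (-q * T) / q)))) ?_).trans_eq ?_
  · filter_upwards [hreg] with ω hω
    exact discountedDividends_le_of_drift_neg hq hω (hC.1.monotone ω) (hD.1.monotone ω) (h0 ω)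
      (fun s _ => le_ceilGrid hcbar n _) (fun s hs => (hD.1.bounds ω s hs).2)
      (fun s hs => ceilGrid_le_add hcbar n (h0 ω s hs))
      (fun s hs => hc.trans (hC.1.bounds ω s hs).1) hpc (by positivity) hT
  · rw [integral_add' iD (integrable_const _)]
    simp

/-- Off an exceptional event only the tail after `T` is lost; on it the loss is at most `cbar / q`.
The event is that claim `N` arrives before `T` or that one of the claims of index below `N` leaves a
surplus in `[0, δ T)`, `δ = cbar / 2 ^ n`. -/
theorem payoff_le_ceilGrid_of_drift_nonneg (hcbar : 0 < cbar) (hq : 0 < q) {ν : Measure ℝ}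
    [IsProbabilityMeasure ν] {K : NNReal} (hν : LipschitzWith K (cdf ν))
    (hW : ∀ i, Measurable (W i)) (hU : ∀ i, Measurable (U i)) (hU_law : ∀ i, μ.map (U i) = ν)
    (hU_indep : iIndepFun U μ)
    (hWU_indep : IndepFun (fun ω i => W i ω) (fun ω i => U i ω) μ)
    (hreg : ∀ᵐ ω ∂μ, IsRegularPath W U ω) {T : ℝ} (hcp : cbar ≤ p) (hT : 0 ≤ T)
    (hx : 0 ≤ x) (hc : 0 ≤ c) {m : ℕ} (hC : C ∈ gridStrategies μ W U p cbar m c) (n N : ℕ) :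
    payoff μ W U p q x C ≤ payoff μ W U p q x (fun t ω => ceilGrid cbar n (C t ω)) +
      (cbar * (Real.exp (-q * T) / q) + (μ.real {ω | arrivalTime W N ω < T} +
        N * (K * (cbar / 2 ^ n * T))) * (cbar / q)) := by
  have hδ : 0 ≤ cbar / 2 ^ n * T := by positivity
  have hD := ceilGrid_mem_gridStrategies hcbar hC n
  have iC := hC.1.integrable_discountedDividends (x := x) hc hq hW hU hreg
  have iD := hD.1.integrable_discountedDividends (x := x) hc hq hW hU hreg
  have h0 : ∀ ω s, 0 ≤ s → 0 ≤ C s ω := fun ω s hs => hc.trans (hC.1.bounds ω s hs).1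
  set S : ℕ → Set Ω := fun i =>
    {ω | preClaimSurplus W U p x C i ω - U i ω ∈ Set.Ico 0 (cbar / 2 ^ n * T)}
  set B : Set Ω := {ω | arrivalTime W N ω < T} ∪ ⋃ i ∈ Finset.range N, S i
  have hB : μ.real B ≤ μ.real {ω | arrivalTime W N ω < T} + N * (K * (cbar / 2 ^ n * T)) := by
    refine (measureReal_union_le _ _).trans ?_
    gcongr
    refine (measureReal_biUnion_finset_le _ _).trans ?_
    refine (Finset.sum_le_card_nsmul _ _ (K * (cbar / 2 ^ n * T)) fun i _ => ?_).trans_eq (by simp)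
    exact ENNReal.toReal_le_of_le_ofReal (by positivity)
      (hC.1.measure_small_surplus_le hν hW hU hU_law hU_indep hWU_indep hreg i hδ)
  -- The measurable hull has the same measure as `B`, so measurability of `B` itself need not be
  -- proved.
  have iB : Integrable ((toMeasurable μ B).indicator fun _ => cbar / q) μ :=
    (integrable_const _).indicator (measurableSet_toMeasurable μ B)
  rw [payoff_eq_integral_discountedDividends, payoff_eq_integral_discountedDividends]
  refine (integral_mono_ae iC (iD.add ((integrable_const
    (cbar * (Real.exp (-q * T) / q))).add iB)) ?_).trans ?_
  · filter_upwards [hreg] with ω hω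
    simp only [Pi.add_apply]
    by_cases hωB : ω ∈ B
    · rw [Set.indicator_of_mem (subset_toMeasurable μ B hωB)]
      have h1 := discountedDividends_le (W := W) (U := U) (p := p) (x := x) hq (hC.1.monotone ω)
        (h0 ω) fun s hs => (hC.1.bounds ω s hs).2
      have h2 : 0 ≤ discountedDividends W U p q x (fun t ω => ceilGrid cbar n (C t ω)) ω :=
        discountedDividends_nonneg fun s hs => hc.trans (hD.1.bounds ω s hs).1
      have h3 : 0 ≤ cbar * (Real.exp (-q * T) / q) := by positivity
      linarith
    · have h1 := discountedDividends_le_of_drift_nonneg (C := C)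
        (D := fun t ω => ceilGrid cbar n (C t ω)) (δ := cbar / 2 ^ n) hq hx hω
        (hC.1.monotone ω) (hD.1.monotone ω) (h0 ω)
        (fun s _ => le_ceilGrid hcbar n _) (fun s hs => (hD.1.bounds ω s hs).2)
        (fun s hs => ceilGrid_le_add hcbar n (h0 ω s hs)) hcp (by positivity) hT ?_
      · have h2 : 0 ≤ (toMeasurable μ B).indicator (fun _ => cbar / q) ω :=
          Set.indicator_nonneg (fun _ _ => by positivity) ω
        linarith
      · intro i hiT hi hmem
        rw [controlledSurplus_arrivalTime hω hi] at hmem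
        simp only [B, Set.mem_union, not_or, Set.mem_ofPred_eq, not_lt, Set.mem_iUnion,
          Finset.mem_range, not_exists] at hωB
        have hiN : i < N := by
          by_contra hcon
          exact absurd (hωB.1.trans (hω.arrivalTime_mono (not_lt.1 hcon))) (not_le.2 hiT)
        exact hωB.2 i hiN hmem
  · rw [integral_add' iD ((integrable_const _).add iB), integral_add' (integrable_const _) iB,
      integral_indicator_const _ (measurableSet_toMeasurable μ B)]
    have hB' : μ.real (toMeasurable μ B) = μ.real B := by
      rw [measureReal_def, measure_toMeasurable, measureReal_def]
    simp only [integral_const, probReal_univ, smul_eq_mul, one_mul, hB']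
    gcongr

omit [IsProbabilityMeasure μ] in
theorem tendsto_measureReal_arrivalTime_lt [IsFiniteMeasure μ] (hW : ∀ i, Measurable (W i))
    (hreg : ∀ᵐ ω ∂μ, IsRegularPath W U ω) (T : ℝ) :
    Tendsto (fun N => μ.real {ω | arrivalTime W N ω < T}) atTop (𝓝 0) := by
  have h := tendsto_measure_of_ae_tendsto_indicator_of_isFiniteMeasure (μ := μ) atTop
    (A := ∅) (As := fun N => {ω | arrivalTime W N ω < T}) MeasurableSet.empty
    (fun N => measurableSet_lt (measurable_arrivalTime hW N) measurable_const) ?_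
  · rw [measure_empty] at h
    simpa [measureReal_def, Function.comp_def] using (ENNReal.tendsto_toReal ENNReal.zero_ne_top).comp h
  · filter_upwards [hreg] with ω hω
    filter_upwards [hω.tendsto_arrivalTime.eventually_ge_atTop T] with N hN
    simpa using hN

theorem exists_exp_neg_mul_lt {q : ℝ} (hq : 0 < q) (a : ℝ) {ε : ℝ} (hε : 0 < ε) :
    ∃ T, 0 ≤ T ∧ a * (Real.exp (-q * T) / q) < ε := by
  have h1 : Tendsto (fun T : ℝ => Real.exp (-q * T)) atTop (𝓝 0) :=
    Real.tendsto_exp_atBot.comp (tendsto_id.const_mul_atTop_of_neg (neg_neg_of_pos hq))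
  have h2 : Tendsto (fun T : ℝ => a * (Real.exp (-q * T) / q)) atTop (𝓝 0) := by
    simpa using (h1.div_const q).const_mul a
  exact ((eventually_ge_atTop 0).and (h2.eventually_lt_const hε)).exists

theorem tendsto_const_div_two_pow (a : ℝ) : Tendsto (fun n : ℕ => a / 2 ^ n) atTop (𝓝 0) :=
  tendsto_const_nhds.div_atTop (tendsto_pow_atTop_atTop_of_one_lt one_lt_two)

theorem tendstoUniformlyOn_Vn_of_drift_neg (hcbar : 0 < cbar) (hq : 0 < q)
    (hW : ∀ i, Measurable (W i)) (hU : ∀ i, Measurable (U i))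
    (hreg : ∀ᵐ ω ∂μ, IsRegularPath W U ω) {c₁ : ℝ} (hc₁ : 0 ≤ c₁) (hpc : p < c₁) :
    TendstoUniformlyOn (fun (n : ℕ) (z : ℝ × ℝ) => Vn μ W U p q cbar n z.1 z.2)
      (fun z : ℝ × ℝ => Vbar μ W U p q cbar z.1 z.2) atTop (Set.Ici 0 ×ˢ Set.Icc c₁ cbar) := by
  refine tendstoUniformlyOn_Vn hcbar hq hW hU hreg hc₁ fun ε hε => ?_
  obtain ⟨T, hT, hTε⟩ := exists_exp_neg_mul_lt hq cbar (half_pos hε)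
  have h1 : Tendsto (fun n : ℕ => cbar * (cbar / 2 ^ n * T / (c₁ - p))) atTop (𝓝 0) := by
    simpa using (((tendsto_const_div_two_pow cbar).mul_const T).div_const (c₁ - p)).const_mul cbar
  filter_upwards [h1.eventually_lt_const (half_pos hε)] with n hn m x _ c hc C hC
  refine (payoff_le_ceilGrid_of_drift_neg hcbar hq hW hU hreg hc₁ hpc hT hc hC n).trans ?_
  rw [mul_add]
  linarith

theorem tendstoUniformlyOn_Vn_of_drift_nonneg (hcbar : 0 < cbar) (hq : 0 < q) {ν : Measure ℝ}
    [IsProbabilityMeasure ν] {K : NNReal} (hν : LipschitzWith K (cdf ν))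
    (hW : ∀ i, Measurable (W i)) (hU : ∀ i, Measurable (U i)) (hU_law : ∀ i, μ.map (U i) = ν)
    (hU_indep : iIndepFun U μ)
    (hWU_indep : IndepFun (fun ω i => W i ω) (fun ω i => U i ω) μ)
    (hreg : ∀ᵐ ω ∂μ, IsRegularPath W U ω) (hcp : cbar ≤ p) :
    TendstoUniformlyOn (fun (n : ℕ) (z : ℝ × ℝ) => Vn μ W U p q cbar n z.1 z.2)
      (fun z : ℝ × ℝ => Vbar μ W U p q cbar z.1 z.2) atTop (Set.Ici 0 ×ˢ Set.Icc 0 cbar) := by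
  refine tendstoUniformlyOn_Vn hcbar hq hW hU hreg le_rfl fun ε hε => ?_
  have hε3 : 0 < ε / 3 := by positivity
  -- The order of choices matters: `T` makes the tail small, then `N` depends on `T`, and finally
  -- `n` is large depending on both.
  obtain ⟨T, hT, hTε⟩ := exists_exp_neg_mul_lt hq cbar hε3
  have h1 : Tendsto (fun N => μ.real {ω | arrivalTime W N ω < T} * (cbar / q)) atTop (𝓝 0) := by
    simpa using (tendsto_measureReal_arrivalTime_lt hW hreg T).mul_const (cbar / q)
  obtain ⟨N, hN⟩ := (h1.eventually_lt_const hε3).exists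
  have h2 : Tendsto (fun n : ℕ => N * (K * (cbar / 2 ^ n * T)) * (cbar / q)) atTop (𝓝 0) := by
    simpa using ((((tendsto_const_div_two_pow cbar).mul_const T).const_mul (K : ℝ)).const_mul
      (N : ℝ)).mul_const (cbar / q)
  filter_upwards [h2.eventually_lt_const hε3] with n hn m x hx c hc C hC
  refine (payoff_le_ceilGrid_of_drift_nonneg hcbar hq hν hW hU hU_law hU_indep hWU_indep hreg hcp
    hT hx hc hC n N).trans ?_
  rw [add_mul]
  linarith

end Values

end Ratcheting

theorem mainTheorem10 {Ω : Type*} [MeasurableSpace Ω] (μ : Measure Ω) [IsProbabilityMeasure μ]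
    (p q β cbar : ℝ) (hq : 0 < q) (hβ : 0 < β) (hcbar : 0 < cbar)
    -- law of the claim sizes: nonnegative, with Lipschitz distribution function, and finite mean
    (ν : Measure ℝ) [IsProbabilityMeasure ν] (hν_nonneg : ν (Set.Iio 0) = 0)
    (hν_lip : ∃ K : NNReal, LipschitzWith K (cdf ν))
    (hν_int : Integrable (fun u : ℝ => u) ν)
    -- safety loading
    (hload : β * (∫ u, u ∂ν) < p)
    -- exponential waiting times between claims, and claim sizes
    (W U : ℕ → Ω → ℝ)
    (hW_meas : ∀ i, Measurable (W i)) (hW_law : ∀ i, μ.map (W i) = expMeasure β)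
    (hW_indep : iIndepFun W μ)
    (hU_meas : ∀ i, Measurable (U i)) (hU_law : ∀ i, μ.map (U i) = ν)
    (hU_indep : iIndepFun U μ)
    (hWU_indep : IndepFun (fun ω i => W i ω) (fun ω i => U i ω) μ) :
    (∀ x : ℝ, 0 ≤ x → ∀ c ∈ Set.Icc (0 : ℝ) cbar,
      Tendsto (fun n : ℕ => Ratcheting.Vn μ W U p q cbar n x c) atTop
        (𝓝 (Ratcheting.Vbar μ W U p q cbar x c))) ∧
    (cbar ≤ p →
      TendstoUniformlyOn (fun (n : ℕ) (z : ℝ × ℝ) => Ratcheting.Vn μ W U p q cbar n z.1 z.2)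
        (fun z : ℝ × ℝ => Ratcheting.Vbar μ W U p q cbar z.1 z.2) atTop
        (Set.Ici 0 ×ˢ Set.Icc 0 cbar)) ∧
    (p < cbar → ∀ c₁ : ℝ, p < c₁ →
      TendstoUniformlyOn (fun (n : ℕ) (z : ℝ × ℝ) => Ratcheting.Vn μ W U p q cbar n z.1 z.2)
        (fun z : ℝ × ℝ => Ratcheting.Vbar μ W U p q cbar z.1 z.2) atTop
        (Set.Ici 0 ×ˢ Set.Icc c₁ cbar)) := by
  obtain ⟨K, hK⟩ := hν_lip
  have hreg := Ratcheting.ae_isRegularPath (U := U) hβ hν_nonneg hW_meas hW_law hW_indep hU_meas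
    hU_law
  -- Safety loading and nonnegative claims give `p > 0`, so `c₁ > p` is nonnegative and all the
  -- rates considered are too.
  have hp : 0 < p := by
    refine lt_of_le_of_lt (mul_nonneg hβ.le (integral_nonneg_of_ae ?_)) hload
    exact (measure_eq_zero_iff_ae_notMem.1 hν_nonneg).mono fun u hu => not_lt.1 hu
  refine ⟨fun x _ c hc => Ratcheting.tendsto_Vn hc.1 hc.2 hq hW_meas hU_meas hreg, fun hcp => ?_,
    fun _ c₁ hc₁ => ?_⟩
  · exact Ratcheting.tendstoUniformlyOn_Vn_of_drift_nonneg hcbar hq hK hW_meas hU_meas hU_law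
      hU_indep hWU_indep hreg hcp
  · exact Ratcheting.tendstoUniformlyOn_Vn_of_drift_neg hcbar hq hW_meas hU_meas hreg
      (hp.le.trans hc₁.le) hc₁
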